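/- Let $F$ be a field, let $n$ be a positive integer, let $K_n$ be the complete graph on the vertex set $[n]=\{1,\dots,n\}$, and let $S=F[x_1,\dots,x_n,y_1,\dots,y_n]$. The parity binomial edge ideal of a graph $G$ on $[n]$ is $\mathcal{I}_G=\langle x_ix_j-y_iy_j : \{i,j\}\in E(G)\rangle\subseteq S$. An $(i,j)$-path of length $r$ in $G$ is a sequence of vertices $\pi=(i_0,\dots,i_r)$ with $i_0=i$, $i_r=j$ and $\{i_k,i_{k+1}\}\in E(G)$ for all $0\le k<r$ (vertices may be repeated); its parity is the parity of $r$, and its interior is $\mathrm{int}(\pi)=\{i_0,\dots,i_r\}\setminus\{i,j\}$. An $(i,j)$-path $\pi$ is minimal if (i) for no $k\in\mathrm{int}(\pi)$ there is an $(i,j)$-path of the same parity as $\pi$ in the subgraph of $G$ induced on the vertices of $\pi$ other than $k$, and (ii) there is no $(i,j)$-path $\pi'$ in $G$ that is shorter than $\pi$ and has the same parity and the same interior as $\pi$. For a minimal $(i,j)$-path $\pi$ let $\mathcal{S}_\pi$ be the set of all polynomials $\pm(x_ix_j-y_iy_j)\prod_{k\in\mathrm{int}(\pi)}t_k$ if $\pi$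 is odd, and of all polynomials $(x_iy_j-y_ix_j)\prod_{k\in\mathrm{int}(\pi)}t_k$ if $\pi$ is even, where each $t_k\in\{x_k,y_k\}$ is arbitrary. Let $\mathcal{S}(\mathcal{I}_G)=\bigcup_\pi\mathcal{S}_\pi\setminus\{0\}$, where $\pi$ runs over all minimal paths in $G$. The universal Gröbner basis of an ideal of $S$ is the union of its reduced Gröbner bases over all monomial orders on $S$. A binomial is a difference $\mathbf{x}^u-\mathbf{x}^v$ of two distinct monic monomials. The Graver basis of an ideal $I$ generated by binomials is the set of its primitive binomials, that is, of the binomials $\mathbf{x}^u-\mathbf{x}^v\in I$ such that there is no other binomial $\mathbf{x}^{u'}-\mathbf{x}^{v'}\in I$ with $\mathbf{x}^{u'}\mid\mathbf{x}^u$ and $\mathbf{x}^{v'}\mid\mathbf{x}^v$. Then the set $\mathcal{S}(\mathcal{I}_{K_n})$, the universal Gröbner basis of $\mathcal{I}_{K_n}$ and the Graver basis of $\mathcal{I}_{K_n}$ coincide. Moreover, the minimal paths in $K_n$ are exactly the paths $(i)$, $(i,j)$, $(i,k,j)$ and $(i,k,l,i)$, where $i,j,k,l$ denote distinct elements of $[n]$.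 -/

import Mathlib

open MvPolynomial

universe u v

noncomputable section

/-- The variable `x_i` of the polynomial ring in the variables `x_i, y_i` (`i ∈ V`). -/
def xVar {V : Type u} (F : Type v) [Field F] (i : V) : MvPolynomial (V ⊕ V) F :=
  X (Sum.inl i)

/-- The variable `y_i` of the polynomial ring in the variables `x_i, y_i` (`i ∈ V`). -/
def yVar {V : Type u} (F : Type v) [Field F] (i : V) : MvPolynomial (V ⊕ V) F :=
  X (Sum.inr i)

/-- The parity binomial edge ideal of `G`, generated by `x_i x_j - y_i y_j`, `{i,j}` an edge. -/
def parityBinomialEdgeIdeal {V : Type u} (F : Type v) [Field F] (G : SimpleGraph V) :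
    Ideal (MvPolynomial (V ⊕ V) F) :=
  Ideal.span {f | ∃ i j : V, G.Adj i j ∧ f = xVar F i * xVar F j - yVar F i * yVar F j}

/-- The interior of an `(i,j)`-path: its set of vertices without `i` and `j`.
A path is an arbitrary sequence of consecutively adjacent vertices, i.e. a walk. -/
def pathInterior {V : Type u} [DecidableEq V] {G : SimpleGraph V} {i j : V}
    (p : G.Walk i j) : Finset V :=
  p.support.toFinset \ {i, j}

/-- Minimal `(i,j)`-paths. In the first condition, a path in the subgraph induced on the vertices
of `p` other than `k` is a path in `G` all of whose vertices are vertices of `p` other than `k`. -/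
def IsMinimalPath {V : Type u} [DecidableEq V] {G : SimpleGraph V} {i j : V}
    (p : G.Walk i j) : Prop :=
  (∀ k ∈ pathInterior p, ¬ ∃ q : G.Walk i j,
      (Even q.length ↔ Even p.length) ∧ ∀ w ∈ q.support, w ∈ p.support ∧ w ≠ k) ∧
  ¬ ∃ q : G.Walk i j, q.length < p.length ∧ (Even q.length ↔ Even p.length) ∧
      pathInterior q = pathInterior p

/-- The set `S_π` of binomials attached to a path `π = p`. -/
def pathBinomials {V : Type u} [DecidableEq V] (F : Type v) [Field F] {G : SimpleGraph V}
    {i j : V} (p : G.Walk i j) : Set (MvPolynomial (V ⊕ V) F) :=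
  {f | ∃ t : V → MvPolynomial (V ⊕ V) F, (∀ k, t k = xVar F k ∨ t k = yVar F k) ∧
    ((Odd p.length ∧
        (f = (xVar F i * xVar F j - yVar F i * yVar F j) * ∏ k ∈ pathInterior p, t k ∨
         f = (yVar F i * yVar F j - xVar F i * xVar F j) * ∏ k ∈ pathInterior p, t k)) ∨
      (Even p.length ∧
        f = (xVar F i * yVar F j - yVar F i * xVar F j) * ∏ k ∈ pathInterior p, t k))}

/-- The set of nonzero binomials attached to the minimal paths of `G`. -/
def minimalPathBinomials {V : Type u} [DecidableEq V] (F : Type v) [Field F]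
    (G : SimpleGraph V) : Set (MvPolynomial (V ⊕ V) F) :=
  {f | ∃ (i j : V) (p : G.Walk i j), IsMinimalPath p ∧ f ∈ pathBinomials F p} \ {0}

/-- `B` is the reduced Gröbner basis of `I` with respect to the monomial order `m`: it is a finite
subset of `I` whose leading terms generate the initial ideal of `I`, its elements have leading
coefficient `1`, and no monomial of an element of `B` is divisible by the leading monomial
of another element of `B`. -/
def IsReducedGroebnerBasis {σ : Type u} {F : Type v} [Field F] (m : MonomialOrder.{u, u} σ)
    (I : Ideal (MvPolynomial σ F)) (B : Set (MvPolynomial σ F)) : Prop :=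
  B.Finite ∧ B ⊆ I ∧
  Ideal.span (m.leadingTerm '' B) = Ideal.span (m.leadingTerm '' (I : Set (MvPolynomial σ F))) ∧
  (∀ b ∈ B, m.leadingCoeff b = 1) ∧
  ∀ b ∈ B, ∀ b' ∈ B, b' ≠ b → ∀ d ∈ b.support, ¬ m.degree b' ≤ d

/-- The universal Gröbner basis of `I`: the union of its reduced Gröbner bases over all monomial
orders. (Every monomial order on `σ →₀ ℕ` can be realised on a type in the universe of `σ`.) -/
def universalGroebnerBasis {σ : Type u} {F : Type v} [Field F] (I : Ideal (MvPolynomial σ F)) :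
    Set (MvPolynomial σ F) :=
  {f | ∃ (m : MonomialOrder.{u, u} σ) (B : Set (MvPolynomial σ F)),
    IsReducedGroebnerBasis m I B ∧ f ∈ B}

/-- The Graver basis of `I`: the set of primitive binomials of `I`. A binomial is a
difference of two distinct monic monomials. -/
def graverBasis {σ : Type u} {F : Type v} [Field F] (I : Ideal (MvPolynomial σ F)) :
    Set (MvPolynomial σ F) :=
  {f | ∃ a b : σ →₀ ℕ, a ≠ b ∧ f = monomial a 1 - monomial b 1 ∧ f ∈ I ∧
    ∀ a' b' : σ →₀ ℕ, a' ≠ b' → (monomial a' 1 - monomial b' 1 : MvPolynomial σ F) ∈ I →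
      a' ≤ a → b' ≤ b → a' = a ∧ b' = b}

end

/-! The equalities follow from a cycle of inclusions: universal Gröbner basis ⊆ Graver basis ⊆ path
binomials ⊆ universal Gröbner basis.

The first holds for every binomial ideal. Such an ideal partitions the exponents into congruence
classes, and the initial ideal consists of the exponents that are not smallest in their class
(`degree_mem_nonstandard`). The reduced Gröbner basis is therefore the set of `x^a - x^b` with `a` a
minimal such exponent and `b` the smallest exponent in its class
(`IsReducedGroebnerBasis.exists_eq_binomial`, `isReducedGroebnerBasis_binomialIdeal`), and these
binomials are primitive.

For the second, congruence over the complete graph has few invariants: the degree at each vertex,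
the parity of the total x-degree, and finer ones for monomials living on one or two vertices. They
force every binomial of the ideal to be termwise divisible by a path binomial
(`CompleteRel.exists_pathPair_le`), so a primitive one is a path binomial.

For the third, a path binomial `x^a - x^b` gets a weight making variables of `b` free, the other
variables of `a` cheap and all remaining ones prohibitive. For an order refining it, `b` is smallest
in its class and `a` is minimal nonstandard; the rigidity behind this is `PathPair.eq_of_le`.

The list of minimal paths rests on the fact that a walk on two vertices of a complete graph
alternates, so its parity is determined by its ends. -/

open scoped MonomialOrder

/-! ### Monomial orders refining a weight -/

section WeightOrder

variable {σ : Type u}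

/-- The exponent vectors, each paired with its weight, in lexicographic order. -/
noncomputable def weightKey (m : MonomialOrder.{u, u} σ) (w : (σ →₀ ℕ) →+ ℕ) :
    (σ →₀ ℕ) →+ ℕ ×ₗ m.syn where
  toFun a := toLex (w a, m.toSyn a)
  map_zero' := by simp only [map_zero]; rfl
  map_add' a b := by simp only [map_add]; rfl

theorem weightKey_injective (m : MonomialOrder.{u, u} σ) (w : (σ →₀ ℕ) →+ ℕ) :
    Function.Injective (weightKey m w) := fun _ _ h =>
  m.toSyn.injective (congrArg (fun x => (ofLex x).2) h)

/-- The monomial order that compares the weights `w` first and breaks ties by `m`. -/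
noncomputable def MonomialOrder.ofWeight (m : MonomialOrder.{u, u} σ) (w : (σ →₀ ℕ) →+ ℕ) :
    MonomialOrder.{u, u} σ where
  -- Not every pair in the lexicographic product comes from an exponent, so the ordered monoid is
  -- the range of the key.
  syn := AddMonoidHom.mrange (weightKey m w)
  addCommMonoidSyn := (AddMonoidHom.mrange (weightKey m w)).toAddCommMonoid
  toSyn :=
    { Equiv.ofBijective (weightKey m w).mrangeRestrict
        ⟨fun _ _ h => weightKey_injective m w (congrArg Subtype.val h),
          (weightKey m w).mrangeRestrict_surjective⟩ with
      map_add' := fun a b => Subtype.ext (map_add (weightKey m w) a b) }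
  toSyn_monotone a b h := by
    obtain ⟨c, rfl⟩ := le_iff_exists_add.1 h
    refine Subtype.coe_le_coe.1 (Prod.Lex.toLex_le_toLex'.2 ⟨?_, fun _ => ?_⟩)
    · change w a ≤ w (a + c)
      simp
    · exact m.toSyn_monotone h

theorem MonomialOrder.ofWeight_lt {m : MonomialOrder.{u, u} σ} {w : (σ →₀ ℕ) →+ ℕ}
    {a b : σ →₀ ℕ} (h : w a < w b) : a ≺[m.ofWeight w] b :=
  Subtype.coe_lt_coe.1 (Prod.Lex.lt_iff.2 (Or.inl h))

theorem MonomialOrder.weight_le_of_ofWeight_le {m : MonomialOrder.{u, u} σ}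
    {w : (σ →₀ ℕ) →+ ℕ} {a b : σ →₀ ℕ} (h : a ≼[m.ofWeight w] b) : w a ≤ w b := by
  by_contra! hlt
  exact absurd h (not_le.2 (ofWeight_lt hlt))

theorem exists_monomialOrder_of_weight [Finite σ] (w : (σ →₀ ℕ) →+ ℕ) :
    ∃ m : MonomialOrder.{u, u} σ, ∀ a b : σ →₀ ℕ, a ≼[m] b → w a ≤ w b := by
  -- Any linear order serves as tie-breaker; finiteness of `σ` gives the well-foundedness that
  -- `MonomialOrder.lex` needs.
  let _ : LinearOrder σ := IsWellOrder.linearOrder WellOrderingRel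
  exact ⟨MonomialOrder.lex.ofWeight w, fun a b => MonomialOrder.weight_le_of_ofWeight_le⟩

end WeightOrder

/-! ### Reduced Gröbner bases and primitive binomials of a binomial ideal -/

section BinomialIdeal

variable {σ : Type u} {F : Type v} [Field F]

/-- The ideal generated by the binomials `x^a - x^b`, for `(a, b) ∈ R`. -/
noncomputable def binomialIdeal (F : Type v) [Field F] (R : Set ((σ →₀ ℕ) × (σ →₀ ℕ))) :
    Ideal (MvPolynomial σ F) :=
  Ideal.span ((fun r => monomial r.1 1 - monomial r.2 1) '' R)

/-- The sum of the coefficients of a polynomial at the monomials in `C`. -/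
noncomputable def coeffSum (F : Type v) [Field F] (C : Set (σ →₀ ℕ)) :
    MvPolynomial σ F →ₗ[F] F :=
  (basisMonomials σ F).constr F (C.indicator 1)

theorem coeffSum_monomial_one (C : Set (σ →₀ ℕ)) (a : σ →₀ ℕ) :
    coeffSum F C (monomial a 1) = C.indicator 1 a := by
  have := (basisMonomials σ F).constr_basis F (C.indicator (1 : (σ →₀ ℕ) → F)) a
  simpa [coeffSum] using this

theorem coeffSum_monomial (C : Set (σ →₀ ℕ)) (a : σ →₀ ℕ) (c : F) :
    coeffSum F C (monomial a c) = c * C.indicator 1 a := by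
  rw [← coeffSum_monomial_one, ← smul_eq_mul, ← map_smul, smul_monomial, smul_eq_mul, mul_one]

/-- Monomial multiples of the generators span the ideal over `F`, and `C` contains both or neither
of the two exponents of each. -/
theorem coeffSum_eq_zero_of_mem {R : Set ((σ →₀ ℕ) × (σ →₀ ℕ))} {C : Set (σ →₀ ℕ)}
    (hC : ∀ r ∈ R, ∀ u, u + r.1 ∈ C ↔ u + r.2 ∈ C) {f : MvPolynomial σ F}
    (hf : f ∈ binomialIdeal F R) : coeffSum F C f = 0 := by
  -- Quantifying over all multiples makes the induction pass through multiplication by ring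
  -- elements.
  suffices h : ∀ g, coeffSum F C (g * f) = 0 by simpa using h 1
  induction hf using Submodule.span_induction with
  | mem x hx =>
    obtain ⟨r, hr, rfl⟩ := hx
    intro g
    induction g using MvPolynomial.induction_on' with
    | monomial u c =>
      simp only [mul_sub, monomial_mul, mul_one, map_sub, coeffSum_monomial]
      have := hC r hr u
      by_cases h : u + r.2 ∈ C <;> simp [h, this]
    | add p q hp hq => rw [add_mul, map_add, hp, hq, add_zero]
  | zero => simp
  | add x y _ _ hx hy => intro g; rw [mul_add, map_add, hx, hy, add_zero]
  | smul a x _ hx => intro g; rw [smul_eq_mul, ← mul_assoc]; exact hx _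

/-- `x^a - x^b` lies in the ideal `I`. -/
def BinomialRel (I : Ideal (MvPolynomial σ F)) (a b : σ →₀ ℕ) : Prop :=
  (monomial a 1 - monomial b 1 : MvPolynomial σ F) ∈ I

namespace BinomialRel

variable {I : Ideal (MvPolynomial σ F)} {a b c : σ →₀ ℕ}

theorem refl (I : Ideal (MvPolynomial σ F)) (a : σ →₀ ℕ) : BinomialRel I a a := by
  simp [BinomialRel]

theorem symm (h : BinomialRel I a b) : BinomialRel I b a := by
  simpa [BinomialRel] using I.neg_mem h

theorem trans (h : BinomialRel I a b) (h' : BinomialRel I b c) : BinomialRel I a c := by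
  simpa [BinomialRel] using I.add_mem h h'

theorem add_left (u : σ →₀ ℕ) (h : BinomialRel I a b) : BinomialRel I (u + a) (u + b) := by
  simpa [BinomialRel, mul_sub, monomial_mul] using I.mul_mem_left (monomial u 1) h

/-- A set of monomials that is closed under the generating moves is a union of classes. -/
theorem mem_iff {R : Set ((σ →₀ ℕ) × (σ →₀ ℕ))} {C : Set (σ →₀ ℕ)}
    (h : BinomialRel (binomialIdeal F R) a b)
    (hC : ∀ r ∈ R, ∀ u, u + r.1 ∈ C ↔ u + r.2 ∈ C) : a ∈ C ↔ b ∈ C := by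
  have := coeffSum_eq_zero_of_mem hC h
  rw [map_sub, coeffSum_monomial_one, coeffSum_monomial_one] at this
  by_cases ha : a ∈ C <;> by_cases hb : b ∈ C <;> simp_all

end BinomialRel

theorem BinomialRel.of_mem {R : Set ((σ →₀ ℕ) × (σ →₀ ℕ))} {r : (σ →₀ ℕ) × (σ →₀ ℕ)}
    (hr : r ∈ R) : BinomialRel (binomialIdeal F R) r.1 r.2 :=
  Ideal.subset_span ⟨r, hr, rfl⟩

/-- The exponents that are not the smallest ones in their class modulo `I`. -/
def nonstandard (m : MonomialOrder.{u, u} σ) (I : Ideal (MvPolynomial σ F)) : Set (σ →₀ ℕ) :=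
  {a | ∃ b, BinomialRel I a b ∧ b ≺[m] a}

variable {m : MonomialOrder.{u, u} σ} {I : Ideal (MvPolynomial σ F)}

theorem isUpperSet_nonstandard : IsUpperSet (nonstandard m I) := by
  rintro a a' h ⟨b, hab, hlt⟩
  obtain ⟨u, rfl⟩ := le_iff_exists_add'.1 h
  exact ⟨u + b, hab.add_left u, by rw [map_add, map_add]; exact add_lt_add_right hlt _⟩

theorem exists_standard (m : MonomialOrder.{u, u} σ) (I : Ideal (MvPolynomial σ F))
    (a : σ →₀ ℕ) : ∃ b, BinomialRel I a b ∧ b ∉ nonstandard m I := by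
  obtain ⟨b, hb, hmin⟩ := (InvImage.wf m.toSyn wellFounded_lt).has_min
    {b | BinomialRel I a b} ⟨a, BinomialRel.refl I a⟩
  exact ⟨b, hb, fun ⟨c, hc, hlt⟩ => hmin c (hb.trans hc) hlt⟩

theorem le_of_notMem_nonstandard {a b : σ →₀ ℕ} (h : BinomialRel I a b)
    (hb : b ∉ nonstandard m I) : b ≼[m] a :=
  not_lt.1 fun hlt => hb ⟨a, h.symm, hlt⟩

theorem eq_of_notMem_nonstandard {a b : σ →₀ ℕ} (h : BinomialRel I a b)
    (ha : a ∉ nonstandard m I) (hb : b ∉ nonstandard m I) : a = b :=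
  m.toSyn.injective
    (le_antisymm (le_of_notMem_nonstandard h.symm ha) (le_of_notMem_nonstandard h hb))

/-- The coefficients of `f` over the class of its leading exponent sum to zero. Were that exponent
smallest in its class, no other exponent of `f` would lie there, and the leading coefficient would
vanish. -/
theorem degree_mem_nonstandard {R : Set ((σ →₀ ℕ) × (σ →₀ ℕ))} {f : MvPolynomial σ F}
    (hf : f ∈ binomialIdeal F R) (h0 : f ≠ 0) :
    m.degree f ∈ nonstandard m (binomialIdeal F R) := by
  by_contra hN
  let C : Set (σ →₀ ℕ) := {c | BinomialRel (binomialIdeal F R) (m.degree f) c}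
  have hC : ∀ r ∈ R, ∀ u, u + r.1 ∈ C ↔ u + r.2 ∈ C := fun r hr u =>
    have h : BinomialRel (binomialIdeal F R) (u + r.1) (u + r.2) :=
      (BinomialRel.of_mem hr).add_left u
    ⟨fun h' => BinomialRel.trans (Set.mem_ofPred.1 h') h,
      fun h' => BinomialRel.trans (Set.mem_ofPred.1 h') h.symm⟩
  have hsum := coeffSum_eq_zero_of_mem hC hf
  rw [f.as_sum, map_sum, Finset.sum_eq_single (m.degree f)] at hsum
  · rw [coeffSum_monomial, Set.indicator_of_mem (s := C) (Set.mem_ofPred.2 (BinomialRel.refl _ _))] at hsum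
    simp only [Pi.one_apply, mul_one] at hsum
    exact m.coeff_degree_ne_zero_iff.2 h0 hsum
  · intro d hd hne
    rw [coeffSum_monomial, Set.indicator_of_notMem, mul_zero]
    intro hdC
    exact hne (m.toSyn.injective
      (le_antisymm (m.le_degree hd) (le_of_notMem_nonstandard (Set.mem_ofPred.1 hdC).symm hN)))
  · intro h
    exact absurd (m.degree_mem_support h0) h

theorem degree_monomial_sub_monomial {a b : σ →₀ ℕ} (h : b ≺[m] a) :
    m.degree (monomial a 1 - monomial b 1 : MvPolynomial σ F) = a := by
  classical
  have ha : m.degree (monomial a 1 : MvPolynomial σ F) = a := by simp [m.degree_monomial]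
  have hb : m.degree (monomial b 1 : MvPolynomial σ F) = b := by simp [m.degree_monomial]
  rw [m.degree_sub_of_lt (by rwa [ha, hb]), ha]

theorem leadingCoeff_monomial_sub_monomial {a b : σ →₀ ℕ} (h : b ≺[m] a) :
    m.leadingCoeff (monomial a 1 - monomial b 1 : MvPolynomial σ F) = 1 := by
  classical
  have hab : b ≠ a := fun hba => by simp [hba] at h
  rw [MonomialOrder.leadingCoeff, degree_monomial_sub_monomial h]
  simp [coeff_monomial, hab]

theorem span_leadingTerm_image_of_monic {B : Set (MvPolynomial σ F)}
    (hB : ∀ b ∈ B, m.leadingCoeff b = 1) :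
    Ideal.span (m.leadingTerm '' B) =
      Ideal.span ((fun s => monomial s (1 : F)) '' (m.degree '' B)) := by
  rw [Set.image_image]
  congr 1
  refine Set.image_congr fun b hb => ?_
  rw [MonomialOrder.leadingTerm, hB b hb]

theorem span_leadingTerm_binomialIdeal (m : MonomialOrder.{u, u} σ)
    (R : Set ((σ →₀ ℕ) × (σ →₀ ℕ))) :
    Ideal.span (m.leadingTerm '' (binomialIdeal F R : Set (MvPolynomial σ F))) =
      Ideal.span ((fun s => monomial s (1 : F)) '' nonstandard m (binomialIdeal F R)) := by
  apply le_antisymm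
  · rw [Ideal.span_le]
    rintro _ ⟨f, hf, rfl⟩
    by_cases h0 : f = 0
    · simp [h0]
    · rw [MonomialOrder.leadingTerm, SetLike.mem_coe, mem_ideal_span_monomial_image]
      intro d hd
      have := support_monomial_subset hd
      rw [Finset.mem_singleton] at this
      exact ⟨_, degree_mem_nonstandard hf h0, this.ge⟩
  · rw [Ideal.span_le]
    rintro _ ⟨a, ⟨b, hab, hlt⟩, rfl⟩
    refine Ideal.subset_span ⟨_, hab, ?_⟩
    rw [MonomialOrder.leadingTerm, degree_monomial_sub_monomial hlt,
      leadingCoeff_monomial_sub_monomial hlt]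

theorem IsReducedGroebnerBasis.exists_degree_le {R : Set ((σ →₀ ℕ) × (σ →₀ ℕ))}
    {B : Set (MvPolynomial σ F)} (hB : IsReducedGroebnerBasis m (binomialIdeal F R) B)
    {a : σ →₀ ℕ} (ha : a ∈ nonstandard m (binomialIdeal F R)) : ∃ g ∈ B, m.degree g ≤ a := by
  classical
  obtain ⟨-, -, hspan, hmonic, -⟩ := hB
  rw [span_leadingTerm_image_of_monic hmonic, span_leadingTerm_binomialIdeal] at hspan
  have h : (monomial a 1 : MvPolynomial σ F) ∈
      Ideal.span ((fun s => monomial s (1 : F)) '' nonstandard m (binomialIdeal F R)) :=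
    Ideal.subset_span ⟨a, ha, rfl⟩
  rw [← hspan, mem_ideal_span_monomial_image] at h
  obtain ⟨_, ⟨g, hg, rfl⟩, hle⟩ := h a (by simp)
  exact ⟨g, hg, hle⟩

/-- Elements of the reduced Gröbner basis of a binomial ideal are differences of a minimal
nonstandard monomial and a standard monomial. -/
theorem IsReducedGroebnerBasis.exists_eq_binomial {R : Set ((σ →₀ ℕ) × (σ →₀ ℕ))}
    {B : Set (MvPolynomial σ F)} (hB : IsReducedGroebnerBasis m (binomialIdeal F R) B)
    {f : MvPolynomial σ F} (hf : f ∈ B) :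
    ∃ a b, Minimal (· ∈ nonstandard m (binomialIdeal F R)) a ∧
      b ∉ nonstandard m (binomialIdeal F R) ∧ BinomialRel (binomialIdeal F R) a b ∧
      f = monomial a 1 - monomial b 1 := by
  classical
  obtain ⟨hfin, hsub, hspan, hmonic, hred⟩ := id hB
  have hf1 : m.leadingCoeff f = 1 := hmonic f hf
  have h0 : f ≠ 0 := by
    rintro rfl
    simp at hf1
  have haN := degree_mem_nonstandard (m := m) (hsub hf) h0
  have hamem := m.degree_mem_support h0
  have hmin : Minimal (· ∈ nonstandard m (binomialIdeal F R)) (m.degree f) := by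
    refine ⟨haN, fun c hc hle => ?_⟩
    obtain ⟨g, hg, hgc⟩ := hB.exists_degree_le hc
    by_cases hgf : g = f
    · exact hgf ▸ hgc
    · exact absurd (hgc.trans hle) (hred f hf g hg hgf _ hamem)
  have hstd : ∀ d ∈ f.support, d ≠ m.degree f → d ∉ nonstandard m (binomialIdeal F R) := by
    intro d hd hne hdN
    obtain ⟨g, hg, hgd⟩ := hB.exists_degree_le hdN
    by_cases hgf : g = f
    · subst hgf
      exact hne (m.toSyn.injective (le_antisymm (m.le_degree hd) (m.toSyn_monotone hgd)))
    · exact hred f hf g hg hgf d hd hgd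
  obtain ⟨b, hab, hb⟩ := exists_standard m (binomialIdeal F R) (m.degree f)
  have hne : b ≠ m.degree f := fun h => hb (h ▸ haN)
  refine ⟨m.degree f, b, hmin, hb, hab, ?_⟩
  by_contra hfne
  -- The leading exponent of this difference is nonstandard. It is not the leading exponent of `f`,
  -- which cancels, nor the standard `b`; so it is a further nonstandard exponent of `f`, against
  -- `hstd`.
  have hg0 : f - (monomial (m.degree f) 1 - monomial b 1) ≠ 0 := sub_ne_zero.2 hfne
  have hgN := degree_mem_nonstandard (m := m)
    ((binomialIdeal F R).sub_mem (hsub hf) hab) hg0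
  have hgs := m.degree_mem_support hg0
  set d := m.degree (f - (monomial (m.degree f) 1 - monomial b 1)) with hd
  have hda : d ≠ m.degree f := by
    intro h
    rw [h, mem_support_iff] at hgs
    apply hgs
    have : coeff (m.degree f) f = 1 := hf1
    simp [coeff_monomial, hne, this]
  have hdb : d ≠ b := fun h => hb (h ▸ hgN)
  refine hstd d ?_ hda hgN
  rw [mem_support_iff] at hgs ⊢
  simpa [coeff_monomial, hda.symm, hdb.symm] using hgs

/-- A divisor `b'` of the standard `b` is standard, so `a'` is nonstandard and minimality gives `a'
= a`. Then `b'` and `b` are standard in the same class, hence equal. -/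
theorem mem_graverBasis_of_minimal {R : Set ((σ →₀ ℕ) × (σ →₀ ℕ))} {a b : σ →₀ ℕ}
    (ha : Minimal (· ∈ nonstandard m (binomialIdeal F R)) a)
    (hb : b ∉ nonstandard m (binomialIdeal F R)) (hab : BinomialRel (binomialIdeal F R) a b) :
    (monomial a 1 - monomial b 1 : MvPolynomial σ F) ∈ graverBasis (binomialIdeal F R) := by
  refine ⟨a, b, fun h => hb (h ▸ ha.1), rfl, hab, fun a' b' hne h ha' hb' => ?_⟩
  have hb'N : b' ∉ nonstandard m (binomialIdeal F R) := fun h => hb (isUpperSet_nonstandard hb' h)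
  have ha'N : a' ∈ nonstandard m (binomialIdeal F R) :=
    ⟨b', h, lt_of_le_of_ne (le_of_notMem_nonstandard h hb'N)
      fun h => hne (m.toSyn.injective h).symm⟩
  have haa : a' = a := le_antisymm ha' (ha.2 ha'N ha')
  subst haa
  exact ⟨rfl, eq_of_notMem_nonstandard (BinomialRel.trans (BinomialRel.symm h) hab) hb'N hb⟩

theorem universalGroebnerBasis_subset_graverBasis (R : Set ((σ →₀ ℕ) × (σ →₀ ℕ))) :
    universalGroebnerBasis (binomialIdeal F R) ⊆ graverBasis (binomialIdeal F R) := by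
  rintro f ⟨m, B, hB, hf⟩
  obtain ⟨a, b, ha, hb, hab, rfl⟩ := hB.exists_eq_binomial hf
  exact mem_graverBasis_of_minimal ha hb hab

theorem isReducedGroebnerBasis_binomialIdeal [Finite σ] (m : MonomialOrder.{u, u} σ)
    (R : Set ((σ →₀ ℕ) × (σ →₀ ℕ))) :
    IsReducedGroebnerBasis m (binomialIdeal F R)
      {f | ∃ a b, Minimal (· ∈ nonstandard m (binomialIdeal F R)) a ∧
        b ∉ nonstandard m (binomialIdeal F R) ∧ BinomialRel (binomialIdeal F R) a b ∧
        f = monomial a 1 - monomial b 1} := by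
  classical
  set N := nonstandard m (binomialIdeal F R) with hN
  have hlt : ∀ {a b}, Minimal (· ∈ N) a → b ∉ N → BinomialRel (binomialIdeal F R) a b →
      b ≺[m] a := fun {a b} ha hb hab =>
    lt_of_le_of_ne (le_of_notMem_nonstandard hab hb)
      fun h => hb (m.toSyn.injective h ▸ ha.1)
  have hmonic : ∀ f ∈ {f : MvPolynomial σ F | ∃ a b, Minimal (· ∈ N) a ∧
      b ∉ N ∧ BinomialRel (binomialIdeal F R) a b ∧ f = monomial a 1 - monomial b 1},
      m.leadingCoeff f = 1 := by
    rintro _ ⟨a, b, ha, hb, hab, rfl⟩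
    exact leadingCoeff_monomial_sub_monomial (hlt ha hb hab)
  refine ⟨?_, ?_, ?_, hmonic, ?_⟩
  -- Dickson's lemma: the minimal elements form an antichain in a well-quasi-order. Each of them has
  -- a single normal form, so the basis is finite as well.
  · have hfin : {a | Minimal (· ∈ N) a}.Finite :=
      WellQuasiOrderedLE.finite_of_isAntichain (setOfPred_minimal_antichain _)
    choose nf hnf hnfN using exists_standard m (binomialIdeal F R)
    refine (hfin.image fun a => (monomial a 1 - monomial (nf a) 1 : MvPolynomial σ F)).subset ?_
    rintro _ ⟨a, b, ha, hb, hab, rfl⟩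
    refine ⟨a, ha, ?_⟩
    have : nf a = b := eq_of_notMem_nonstandard ((hnf a).symm.trans hab) (hnfN a) hb
    simp only [this]
  · rintro _ ⟨a, b, ha, hb, hab, rfl⟩
    exact hab
  · rw [span_leadingTerm_image_of_monic hmonic, span_leadingTerm_binomialIdeal]
    apply le_antisymm
    · refine Ideal.span_mono (Set.image_mono ?_)
      rintro _ ⟨_, ⟨a, b, ha, hb, hab, rfl⟩, rfl⟩
      rw [degree_monomial_sub_monomial (hlt ha hb hab)]
      exact ha.1
    · rw [Ideal.span_le]
      rintro _ ⟨c, hc, rfl⟩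
      rw [SetLike.mem_coe, mem_ideal_span_monomial_image]
      intro d hd
      have hd' := support_monomial_subset hd
      rw [Finset.mem_singleton] at hd'
      obtain ⟨a, hac, ha⟩ := exists_minimal_le_of_wellFoundedLT (· ∈ N) c hc
      obtain ⟨b, hab, hb⟩ := exists_standard m (binomialIdeal F R) a
      refine ⟨a, ⟨_, ⟨a, b, ha, hb, hab, rfl⟩, ?_⟩, hac.trans hd'.ge⟩
      exact degree_monomial_sub_monomial (hlt ha hb hab)
  · rintro _ ⟨a, b, ha, hb, hab, rfl⟩ _ ⟨a', b', ha', hb', hab', rfl⟩ hne d hd hle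
    rw [degree_monomial_sub_monomial (hlt ha' hb' hab')] at hle
    have hd' : d = a ∨ d = b := by
      have := support_sub σ _ _ hd
      rw [Finset.mem_union] at this
      exact this.imp (fun h => Finset.mem_singleton.1 (support_monomial_subset h))
        (fun h => Finset.mem_singleton.1 (support_monomial_subset h))
    rcases hd' with rfl | rfl
    · have haa : a' = d := le_antisymm hle (ha.2 ha'.1 hle)
      subst haa
      rw [eq_of_notMem_nonstandard (hab'.symm.trans hab) hb' hb] at hne
      exact hne rfl
    · exact hb (isUpperSet_nonstandard hle ha'.1)

theorem mem_universalGroebnerBasis_of_minimal [Finite σ] {R : Set ((σ →₀ ℕ) × (σ →₀ ℕ))}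
    {a b : σ →₀ ℕ} (ha : Minimal (· ∈ nonstandard m (binomialIdeal F R)) a)
    (hb : b ∉ nonstandard m (binomialIdeal F R)) (hab : BinomialRel (binomialIdeal F R) a b) :
    (monomial a 1 - monomial b 1 : MvPolynomial σ F) ∈
      universalGroebnerBasis (binomialIdeal F R) :=
  ⟨m, _, isReducedGroebnerBasis_binomialIdeal m R, a, b, ha, hb, hab, rfl⟩

end BinomialIdeal

/-! ### Congruence over the complete graph: invariants and moves -/

section PathPairs

variable {V : Type u} {F : Type v} [Field F]

/-- The exponents of the two terms of the generators of the parity binomial edge ideal. -/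
def edgeMoves (G : SimpleGraph V) : Set ((V ⊕ V →₀ ℕ) × (V ⊕ V →₀ ℕ)) :=
  {r | ∃ i j, G.Adj i j ∧ r = (Finsupp.single (Sum.inl i) 1 + Finsupp.single (Sum.inl j) 1,
    Finsupp.single (Sum.inr i) 1 + Finsupp.single (Sum.inr j) 1)}

theorem parityBinomialEdgeIdeal_eq_binomialIdeal (G : SimpleGraph V) :
    parityBinomialEdgeIdeal F G = binomialIdeal F (edgeMoves G) := by
  unfold parityBinomialEdgeIdeal binomialIdeal
  congr 1
  ext f
  constructor
  · rintro ⟨i, j, h, rfl⟩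
    exact ⟨_, ⟨i, j, h, rfl⟩, by simp [xVar, yVar, X, monomial_mul]⟩
  · rintro ⟨_, ⟨i, j, h, rfl⟩, rfl⟩
    exact ⟨i, j, h, by simp [xVar, yVar, X, monomial_mul]⟩

/-- The vertex `i` of a variable `x_i` or `y_i`. -/
def varVertex : V ⊕ V → V := Sum.elim id id

@[simp] theorem varVertex_inl (i : V) : varVertex (Sum.inl i) = i := rfl

@[simp] theorem varVertex_inr (i : V) : varVertex (Sum.inr i) = i := rfl

@[simp] theorem varVertex_swap (p : V ⊕ V) : varVertex p.swap = varVertex p := by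
  cases p <;> rfl

@[simp] theorem isLeft_swap_eq_not (p : V ⊕ V) : p.swap.isLeft = !p.isLeft := by
  cases p <;> rfl

theorem swap_ne_self (p : V ⊕ V) : p.swap ≠ p := by
  cases p <;> simp

theorem eq_or_eq_swap_of_varVertex_eq {p q : V ⊕ V} (h : varVertex p = varVertex q) :
    p = q ∨ p = q.swap := by
  rcases p with i | i <;> rcases q with j | j <;> simp_all [varVertex]

/-- The exponent vector of the variable `p`. -/
noncomputable abbrev varExp (p : V ⊕ V) : V ⊕ V →₀ ℕ := Finsupp.single p 1

/-- Congruence of monomials modulo the parity binomial edge ideal of the complete graph. -/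
abbrev CompleteRel (F : Type v) [Field F] (a b : V ⊕ V →₀ ℕ) : Prop :=
  BinomialRel (binomialIdeal F (edgeMoves (⊤ : SimpleGraph V))) a b

theorem BinomialRel.map_eq {σ : Type u} {R : Set ((σ →₀ ℕ) × (σ →₀ ℕ))} {a b : σ →₀ ℕ}
    {α : Type*} (h : BinomialRel (binomialIdeal F R) a b) (φ : (σ →₀ ℕ) → α)
    (hφ : ∀ r ∈ R, ∀ u, φ (u + r.1) = φ (u + r.2)) : φ a = φ b := by
  have := h.mem_iff (C := {c | φ c = φ a}) fun r hr u => by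
    simp only [Set.mem_ofPred, hφ r hr u]
  simpa only [Set.mem_ofPred, true_iff, eq_comm] using this

namespace CompleteRel

variable {a b : V ⊕ V →₀ ℕ}

/-- The generators are homogeneous for the grading in which `x_i` and `y_i` both have the degree of
the vertex `i`. -/
theorem add_swap (h : CompleteRel F a b) (p : V ⊕ V) :
    a p + a p.swap = b p + b p.swap := by
  classical
  refine h.map_eq (fun c => c p + c p.swap) ?_
  rintro _ ⟨i, j, -, rfl⟩ u
  rcases p with k | k <;> simp [Finsupp.single_apply] <;> omega

/-- Each move changes the number of x-variables by two. -/
theorem sum_inl [Fintype V] (h : CompleteRel F a b) :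
    ∑ v, (a (Sum.inl v) : ZMod 2) = ∑ v, (b (Sum.inl v) : ZMod 2) := by
  classical
  refine h.map_eq (fun c => ∑ v, (c (Sum.inl v) : ZMod 2)) ?_
  rintro _ ⟨i, j, -, rfl⟩ u
  simp only [Finsupp.add_apply, Finsupp.single_apply, Nat.cast_add, Finset.sum_add_distrib]
  simp
  rfl

/-- The parity of the x-degree localises to the two vertices where `a` and `b` may differ. By
`add_swap` it does not matter whether x- or y-exponents are counted there. -/
theorem parity_of_eq_off_pair [Fintype V] (h : CompleteRel F a b) {p q : V ⊕ V}
    (hpq : varVertex p ≠ varVertex q)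
    (hoff : ∀ r, varVertex r ≠ varVertex p → varVertex r ≠ varVertex q → a r = b r) :
    (a p + a q + b p + b q) % 2 = 0 := by
  classical
  have hs := h.sum_inl
  have hp := h.add_swap p
  have hq := h.add_swap q
  rw [← Finset.add_sum_erase _ _ (Finset.mem_univ (varVertex p)),
    ← Finset.add_sum_erase _ _ (Finset.mem_univ (varVertex p)),
    ← Finset.add_sum_erase _ _ (Finset.mem_erase.2 ⟨hpq.symm, Finset.mem_univ (varVertex q)⟩),
    ← Finset.add_sum_erase _ _ (Finset.mem_erase.2 ⟨hpq.symm, Finset.mem_univ (varVertex q)⟩),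
    Finset.sum_congr rfl (g := fun v => (b (Sum.inl v) : ZMod 2)), ← add_assoc, ← add_assoc,
    add_left_inj] at hs
  · norm_cast at hs
    rw [ZMod.natCast_eq_natCast_iff'] at hs
    rcases p with i | i <;> rcases q with j | j <;> simp at hs hp hq <;> omega
  · intro v hv
    simp only [Finset.mem_erase] at hv
    rw [hoff (Sum.inl v) (by simpa using hv.2.1) (by simpa using hv.1)]

theorem parity_of_eq_off [Fintype V] (h : CompleteRel F a b) {p : V ⊕ V}
    (hoff : ∀ r, varVertex r ≠ varVertex p → a r = b r) : (a p + b p) % 2 = 0 := by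
  classical
  have hs := h.sum_inl
  have hp := h.add_swap p
  rw [← Finset.add_sum_erase _ _ (Finset.mem_univ (varVertex p)),
    ← Finset.add_sum_erase _ _ (Finset.mem_univ (varVertex p)),
    Finset.sum_congr rfl (g := fun v => (b (Sum.inl v) : ZMod 2)),
    add_left_inj] at hs
  · rw [ZMod.natCast_eq_natCast_iff'] at hs
    rcases p with i | i <;> simp at hs hp <;> omega
  · intro v hv
    simp only [Finset.mem_erase] at hv
    rw [hoff (Sum.inl v) (by simpa using hv.1)]

/-- No move applies to a monomial on a single vertex, since an edge has distinct ends. -/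
theorem eq_of_support_subset (h : CompleteRel F a b) {p : V ⊕ V}
    (hoff : ∀ r, varVertex r ≠ varVertex p → a r = 0) : a = b := by
  classical
  -- The support condition is a premise inside `C`, so exponents involving other vertices belong to
  -- `C` vacuously and `C` is closed under every move.
  have := h.mem_iff (C := {c | (∀ r, varVertex r ≠ varVertex p → c r = 0) → c = a}) ?_
  · refine ((this.1 fun _ => rfl) fun r hr => ?_).symm
    have := h.add_swap r
    rw [hoff r hr, hoff r.swap (by simpa using hr)] at this
    omega
  · have key : ∀ (q r : V ⊕ V) (u : V ⊕ V →₀ ℕ), varVertex q ≠ varVertex r →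
        ¬ ∀ s, varVertex s ≠ varVertex p → (u + (varExp q + varExp r)) s = 0 := by
      intro q r u hqr hs
      by_cases hq : varVertex q = varVertex p
      · have := hs r (by rw [← hq]; exact hqr.symm)
        simp at this
      · have := hs q hq
        simp at this
    rintro _ ⟨i, j, hij, rfl⟩ u
    have hij' : i ≠ j := hij
    exact ⟨fun _ h => absurd h (key (Sum.inr i) (Sum.inr j) u hij'),
      fun _ h => absurd h (key (Sum.inl i) (Sum.inl j) u hij')⟩

/-- On two vertices the only move exchanges `x_v x_w` and `y_v y_w`, which shifts both x-exponents
equally. -/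
theorem sub_eq_sub_of_support_subset (h : CompleteRel F a b) {v w : V} (hvw : v ≠ w)
    (hoff : ∀ r, varVertex r ≠ v → varVertex r ≠ w → a r = 0) :
    (a (Sum.inl v) : ℤ) - a (Sum.inl w) = b (Sum.inl v) - b (Sum.inl w) := by
  classical
  have := h.mem_iff (C := {c | (∀ r, varVertex r ≠ v → varVertex r ≠ w → c r = 0) →
    (a (Sum.inl v) : ℤ) - a (Sum.inl w) = c (Sum.inl v) - c (Sum.inl w)}) ?_
  · refine (this.1 fun _ => rfl) fun r hr hr' => ?_
    have := h.add_swap r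
    rw [hoff r hr hr', hoff r.swap (by simpa using hr) (by simpa using hr')] at this
    omega
  · rintro _ ⟨i, j, hij, rfl⟩ u
    have hij' : i ≠ j := hij
    have key : ∀ p q : V ⊕ V, (∀ r, varVertex r ≠ v → varVertex r ≠ w →
          (u + (varExp p + varExp q)) r = 0) ↔
        (∀ r, varVertex r ≠ v → varVertex r ≠ w → u r = 0) ∧
          (varVertex p = v ∨ varVertex p = w) ∧ (varVertex q = v ∨ varVertex q = w) := by
      intro p q
      simp only [Finsupp.add_apply, Finsupp.single_apply]
      constructor
      · refine fun hs => ⟨fun r h h' => ?_, ?_, ?_⟩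
        · have := hs r h h'
          omega
        · by_contra! hp
          simpa using hs p hp.1 hp.2
        · by_contra! hq
          simpa using hs q hq.1 hq.2
      · rintro ⟨hu, hp, hq⟩ r h h'
        rw [hu r h h', if_neg (by rintro rfl; exact hp.elim h h'),
          if_neg (by rintro rfl; exact hq.elim h h')]
        rfl
    simp only [Set.mem_ofPred]
    rw [key, key]
    refine forall_congr' fun hs => ?_
    have := hs.2
    simp only [Finsupp.add_apply, Finsupp.single_apply, Sum.inl.injEq, reduceCtorEq, if_false,
      varVertex_inl] at this ⊢
    grind

theorem add_eq_add_of_isLeft_eq (h : CompleteRel F a b) {p q : V ⊕ V}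
    (hpq : varVertex p ≠ varVertex q) (hs : p.isLeft = q.isLeft)
    (hoff : ∀ r, varVertex r ≠ varVertex p → varVertex r ≠ varVertex q → a r = 0) :
    a p + b q = b p + a q := by
  have h1 := h.sub_eq_sub_of_support_subset hpq hoff
  have hp := h.add_swap p
  have hq := h.add_swap q
  rcases p with i | i <;> rcases q with j | j <;> simp at hs h1 hp hq <;> omega

theorem add_eq_add_of_isLeft_ne (h : CompleteRel F a b) {p q : V ⊕ V}
    (hpq : varVertex p ≠ varVertex q) (hs : p.isLeft ≠ q.isLeft)
    (hoff : ∀ r, varVertex r ≠ varVertex p → varVertex r ≠ varVertex q → a r = 0) :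
    a p + a q = b p + b q := by
  have h1 := h.sub_eq_sub_of_support_subset hpq hoff
  have hp := h.add_swap p
  have hq := h.add_swap q
  rcases p with i | i <;> rcases q with j | j <;> simp at hs h1 hp hq <;> omega

theorem odd_move {p q : V ⊕ V} (hpq : varVertex p ≠ varVertex q) (hs : p.isLeft = q.isLeft) :
    CompleteRel F (varExp p + varExp q) (varExp p.swap + varExp q.swap) := by
  rcases p with i | i <;> rcases q with j | j
  · exact BinomialRel.of_mem (r := (_, _)) ⟨i, j, hpq, rfl⟩
  · simp at hs
  · simp at hs
  · refine BinomialRel.symm ?_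
    exact BinomialRel.of_mem (r := (_, _)) ⟨i, j, hpq, rfl⟩

/-- The variable `t` is a catalyst: the edge move on `p` and `t` flips it, and the edge move on `q`
and `t.swap` flips it back. -/
theorem even_move_of_isLeft_eq {p q t : V ⊕ V}
    (hs : p.isLeft ≠ q.isLeft) (htp : varVertex t ≠ varVertex p)
    (htq : varVertex t ≠ varVertex q) (ht : p.isLeft = t.isLeft) :
    CompleteRel F (varExp p + varExp q + varExp t) (varExp p.swap + varExp q.swap + varExp t) := by
  have h1 := (odd_move (F := F) htp.symm ht).add_left (varExp q)
  have h2 := (odd_move (F := F) (p := q) (q := t.swap) (by simpa using htq.symm)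
    (by rw [isLeft_swap_eq_not, ← ht]; revert hs; cases p.isLeft <;> cases q.isLeft <;> simp)
    ).add_left (varExp p.swap)
  rw [Sum.swap_swap] at h2
  have e1 : varExp p + varExp q + varExp t = varExp q + (varExp p + varExp t) := by abel
  have e2 : varExp q + (varExp p.swap + varExp t.swap) =
    varExp p.swap + (varExp q + varExp t.swap) := by abel
  rw [e1, add_assoc]
  rw [e2] at h1
  exact h1.trans h2

theorem even_move {p q t : V ⊕ V}
    (hs : p.isLeft ≠ q.isLeft) (htp : varVertex t ≠ varVertex p)
    (htq : varVertex t ≠ varVertex q) :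
    CompleteRel F (varExp p + varExp q + varExp t) (varExp p.swap + varExp q.swap + varExp t) := by
  by_cases ht : p.isLeft = t.isLeft
  · exact even_move_of_isLeft_eq hs htp htq ht
  · have ht' : q.isLeft = t.isLeft := by
      revert hs ht; cases p.isLeft <;> cases q.isLeft <;> cases t.isLeft <;> simp
    have := even_move_of_isLeft_eq (F := F) hs.symm htq htp ht'
    rwa [add_comm (varExp q), add_comm (varExp q.swap)] at this

/-- One copy of `p` is flipped together with `t`, and the other together with `t.swap`. One of these
is an edge move and the other an even move catalysed by `t'`; the type of `t` decides which. -/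
theorem loop_move {p t t' : V ⊕ V} (htp : varVertex t ≠ varVertex p)
    (htp' : varVertex t' ≠ varVertex p) (htt : varVertex t ≠ varVertex t') :
    CompleteRel F (varExp p + varExp p + (varExp t + varExp t'))
      (varExp p.swap + varExp p.swap + (varExp t + varExp t')) := by
  by_cases ht : p.isLeft = t.isLeft
  · have h1 := (odd_move (F := F) htp.symm ht).add_left (varExp p + varExp t')
    have h2 := (even_move (F := F) (p := p) (q := t.swap) (t := t')
      (by rw [isLeft_swap_eq_not, ht]; cases t.isLeft <;> simp) htp' (by simpa using htt.symm)).add_left (varExp p.swap)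
    rw [Sum.swap_swap] at h2
    convert h1.trans (c := varExp p.swap + (varExp p.swap + varExp t + varExp t')) ?_ using 1
    · abel
    · abel
    · convert h2 using 1
      abel
  · have h1 := (even_move (F := F) (p := p) (q := t) (t := t') ht htp'
      htt.symm).add_left (varExp p)
    have h2 := (odd_move (F := F) (p := p) (q := t.swap) (by simpa using htp.symm)
      (by rw [isLeft_swap_eq_not]; revert ht; cases p.isLeft <;> cases t.isLeft <;> simp)
      ).add_left (varExp p.swap + varExp t')
    rw [Sum.swap_swap] at h2
    convert h1.trans (c := varExp p.swap + varExp t' + (varExp p.swap + varExp t)) ?_ using 1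
    · abel
    · abel
    · convert h2 using 1
      abel

end CompleteRel

/-- The pairs of exponents of the binomials attached to the minimal paths in a complete graph. -/
inductive PathPair : (V ⊕ V →₀ ℕ) → (V ⊕ V →₀ ℕ) → Prop
  | odd (p q : V ⊕ V) (hpq : varVertex p ≠ varVertex q) (hs : p.isLeft = q.isLeft) :
    PathPair (varExp p + varExp q) (varExp p.swap + varExp q.swap)
  | even (p q t : V ⊕ V) (hpq : varVertex p ≠ varVertex q) (hs : p.isLeft ≠ q.isLeft)
    (htp : varVertex t ≠ varVertex p) (htq : varVertex t ≠ varVertex q) :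
    PathPair (varExp p + varExp q + varExp t) (varExp p.swap + varExp q.swap + varExp t)
  | loop (p t t' : V ⊕ V) (htp : varVertex t ≠ varVertex p) (htp' : varVertex t' ≠ varVertex p)
    (htt : varVertex t ≠ varVertex t') :
    PathPair (varExp p + varExp p + (varExp t + varExp t'))
      (varExp p.swap + varExp p.swap + (varExp t + varExp t'))

theorem PathPair.completeRel {a b : V ⊕ V →₀ ℕ} (h : PathPair a b) : CompleteRel F a b := by
  cases h with
  | odd p q hpq hs => exact CompleteRel.odd_move hpq hs
  | even p q t hpq hs htp htq => exact CompleteRel.even_move hs htp htq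
  | loop p t t' htp htp' htt => exact CompleteRel.loop_move htp htp' htt

end PathPairs

/-! ### Divisibility by path pairs, and their place in the universal Gröbner basis -/

section PathPairs

variable {V : Type u} {F : Type v} [Field F]

theorem varExp_add_le {p q : V ⊕ V} {a : V ⊕ V →₀ ℕ} (hpq : p ≠ q) (hp : 0 < a p)
    (hq : 0 < a q) : varExp p + varExp q ≤ a := by
  classical
  intro s
  simp only [Finsupp.add_apply, Finsupp.single_apply]
  grind

theorem varExp_add_add_le {p q t : V ⊕ V} {a : V ⊕ V →₀ ℕ} (hpq : p ≠ q) (htp : t ≠ p)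
    (htq : t ≠ q) (hp : 0 < a p) (hq : 0 < a q) (ht : 0 < a t) :
    varExp p + varExp q + varExp t ≤ a := by
  classical
  intro s
  simp only [Finsupp.add_apply, Finsupp.single_apply]
  grind

theorem varExp_two_add_le {p t t' : V ⊕ V} {a : V ⊕ V →₀ ℕ} (htp : t ≠ p) (htp' : t' ≠ p)
    (htt : t ≠ t') (hp : 2 ≤ a p) (ht : 0 < a t) (ht' : 0 < a t') :
    varExp p + varExp p + (varExp t + varExp t') ≤ a := by
  classical
  intro s
  simp only [Finsupp.add_apply, Finsupp.single_apply]
  grind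

theorem ne_of_varVertex_ne {p q : V ⊕ V} (h : varVertex p ≠ varVertex q) : p ≠ q :=
  fun h' => h (congrArg _ h')

/-- Every binomial in the ideal is termwise divisible by one attached to a minimal path. -/
theorem CompleteRel.exists_pathPair_le [Fintype V] {a b : V ⊕ V →₀ ℕ} (h : CompleteRel F a b)
    (hab : a ≠ b) : ∃ a' b', PathPair a' b' ∧ a' ≤ a ∧ b' ≤ b := by
  have odd_case : ∀ p q : V ⊕ V, varVertex p ≠ varVertex q → p.isLeft = q.isLeft →
      b p < a p → b q < a q → ∃ a' b', PathPair a' b' ∧ a' ≤ a ∧ b' ≤ b := by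
    intro p q hpq hs hp hq
    have hp' := h.add_swap p
    have hq' := h.add_swap q
    exact ⟨_, _, PathPair.odd p q hpq hs,
      varExp_add_le (ne_of_varVertex_ne hpq) (by omega) (by omega),
      varExp_add_le (ne_of_varVertex_ne (by simpa using hpq)) (by omega) (by omega)⟩
  -- If no exponent drops, equality of vertex degrees forces `a = b`.
  obtain ⟨p, hp⟩ : ∃ p, b p < a p := by
    by_contra! hle
    refine hab (Finsupp.ext fun p => ?_)
    have := h.add_swap p
    have := hle p
    have := hle p.swap
    omega
  have hp' := h.add_swap p
  by_cases hq : ∃ q, varVertex q ≠ varVertex p ∧ b q < a q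
  · obtain ⟨q, hqp, hq⟩ := hq
    have hq' := h.add_swap q
    by_cases hs : p.isLeft = q.isLeft
    · exact odd_case p q hqp.symm hs hp hq
    by_cases hr : ∃ r, varVertex r ≠ varVertex p ∧ varVertex r ≠ varVertex q ∧ 0 < a r
    · obtain ⟨r, hrp, hrq, hr⟩ := hr
      by_cases hbr : 0 < b r
      · exact ⟨_, _, PathPair.even p q r hqp.symm hs hrp hrq,
          varExp_add_add_le (ne_of_varVertex_ne hqp.symm) (ne_of_varVertex_ne hrp)
            (ne_of_varVertex_ne hrq) (by omega) (by omega) hr,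
          varExp_add_add_le (ne_of_varVertex_ne (by simpa using hqp.symm))
            (ne_of_varVertex_ne (by simpa using hrp)) (ne_of_varVertex_ne (by simpa using hrq))
            (by omega) (by omega) hbr⟩
      -- Here `r` drops too, and its type agrees with that of `p` or of `q`, which are opposite: an
      -- odd pair results.
      · by_cases hsr : p.isLeft = r.isLeft
        · exact odd_case p r hrp.symm hsr hp (by omega)
        · refine odd_case q r hrq.symm ?_ hq (by omega)
          revert hs hsr
          cases p.isLeft <;> cases q.isLeft <;> cases r.isLeft <;> simp
    -- With no third vertex, the two-vertex invariant forbids opposite types from dropping together.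
    · push Not at hr
      have := h.add_eq_add_of_isLeft_ne hqp.symm hs
        fun r hrp hrq => Nat.le_zero.1 (hr r hrp hrq)
      omega
  -- Only the vertex of `p` changes, so by parity its exponent drops by at least two. A loop pair
  -- divides once two further vertices occur; with fewer, the one- and two-vertex invariants give a
  -- contradiction.
  · push Not at hq
    have heq : ∀ r, varVertex r ≠ varVertex p → a r = b r := by
      intro r hr
      have := h.add_swap r
      have := hq r hr
      have := hq r.swap (by simpa using hr)
      omega
    have hpar := h.parity_of_eq_off heq
    by_cases ht : ∃ t, varVertex t ≠ varVertex p ∧ 0 < a t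
    · obtain ⟨t, htp, ht⟩ := ht
      by_cases ht' : ∃ t', varVertex t' ≠ varVertex p ∧ varVertex t ≠ varVertex t' ∧ 0 < a t'
      · obtain ⟨t', htp', htt, ht'⟩ := ht'
        have h1 := heq t htp
        have h2 := heq t' htp'
        exact ⟨_, _, PathPair.loop p t t' htp htp' htt,
          varExp_two_add_le (ne_of_varVertex_ne htp) (ne_of_varVertex_ne htp')
            (ne_of_varVertex_ne htt) (by omega) ht ht',
          varExp_two_add_le (ne_of_varVertex_ne (by simpa using htp))
            (ne_of_varVertex_ne (by simpa using htp')) (ne_of_varVertex_ne htt) (by omega)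
            (by omega) (by omega)⟩
      · push Not at ht'
        have hoff : ∀ r, varVertex r ≠ varVertex p → varVertex r ≠ varVertex t → a r = 0 :=
          fun r hrp hrt => Nat.le_zero.1 (ht' r hrp hrt.symm)
        have h1 := heq t htp
        by_cases hs : p.isLeft = t.isLeft
        · have := h.add_eq_add_of_isLeft_eq htp.symm hs hoff
          omega
        · have := h.add_eq_add_of_isLeft_ne htp.symm hs hoff
          omega
    · push Not at ht
      exact absurd (h.eq_of_support_subset (p := p) fun r hr => Nat.le_zero.1 (ht r hr)) hab

theorem eq_swap_or_varVertex_ne (p s : V ⊕ V) :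
    s = p ∨ s = p.swap ∨ varVertex s ≠ varVertex p := by
  by_cases h : varVertex s = varVertex p
  · rcases eq_or_eq_swap_of_varVertex_eq h with h | h <;> simp [h]
  · exact Or.inr (Or.inr h)

theorem CompleteRel.eq_of_eq_off_pair {c d : V ⊕ V →₀ ℕ} (h : CompleteRel F c d) {p q : V ⊕ V}
    (hoff : ∀ r, varVertex r ≠ varVertex p → varVertex r ≠ varVertex q → c r = d r)
    (hp : c p = d p) (hq : c q = d q) : c = d := by
  refine Finsupp.ext fun s => ?_
  have hp' := h.add_swap p
  have hq' := h.add_swap q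
  rcases eq_swap_or_varVertex_ne p s with rfl | rfl | hsp
  · exact hp
  · omega
  · rcases eq_swap_or_varVertex_ne q s with rfl | rfl | hsq
    · exact hq
    · omega
    · exact hoff s hsp hsq

/-- The vertices in a pair are distinct, so no term contains both `x_i` and `y_i`. Vertex degrees
then determine the term from its variables. -/
theorem PathPair.swap_eq_zero {a b : V ⊕ V →₀ ℕ} (h : PathPair a b) {s : V ⊕ V}
    (hs : b s ≠ 0) : b s.swap = 0 := by
  classical
  have key : ∀ r, varVertex r ≠ varVertex s → r ≠ s ∧ r ≠ s.swap := fun r hr =>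
    ⟨ne_of_varVertex_ne hr, ne_of_varVertex_ne (by simpa using hr)⟩
  have n := swap_ne_self s
  cases h with
  | odd p q hpq _ =>
    rw [← varVertex_swap p, ← varVertex_swap q] at hpq
    generalize p.swap = p, q.swap = q at *
    simp only [Finsupp.add_apply, Finsupp.single_apply] at hs ⊢
    grind
  | even p q t hpq _ htp htq =>
    rw [← varVertex_swap p] at hpq htp
    rw [← varVertex_swap q] at hpq htq
    generalize p.swap = p, q.swap = q at *
    simp only [Finsupp.add_apply, Finsupp.single_apply] at hs ⊢
    grind
  | loop p t t' htp htp' htt =>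
    rw [← varVertex_swap p] at htp htp'
    generalize p.swap = p at *
    simp only [Finsupp.add_apply, Finsupp.single_apply] at hs ⊢
    grind

theorem PathPair.eq_of_support_subset {a b d : V ⊕ V →₀ ℕ} (h : PathPair a b)
    (hbd : CompleteRel F b d) (hd : ∀ s, b s = 0 → d s = 0) : d = b := by
  refine Finsupp.ext fun s => ?_
  by_cases hs : b s = 0
  · rw [hs, hd s hs]
  · have h0 := h.swap_eq_zero hs
    have := hbd.add_swap s
    rw [h0, hd _ h0] at this
    omega

/-- A binomial in the ideal whose first term divides that of a pair, and whose second term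
only involves variables of the pair, is the pair itself. -/
theorem PathPair.eq_of_le [Fintype V] {a b c d : V ⊕ V →₀ ℕ} (hab : PathPair a b) (hca : c ≤ a)
    (hcd : CompleteRel F c d) (hne : c ≠ d) (hd : ∀ s, a s = 0 → b s = 0 → d s = 0) :
    c = a ∧ d = b := by
  classical
  -- Once `c = a`, the exponents `d` and `b` are congruent, and it is enough that `d` involves no
  -- variable outside `b`.
  suffices h : a ≤ c ∧ ∀ s, a s ≠ 0 → b s = 0 → d s = 0 by
    have hc : c = a := le_antisymm hca h.1
    subst hc
    refine ⟨rfl, hab.eq_of_support_subset (hab.completeRel.symm.trans hcd) fun s hs => ?_⟩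
    by_cases has : c s = 0
    · exact hd s has hs
    · exact h.2 s has hs
  cases hab with
  | odd p q hpq hs =>
    have n1 : p ≠ q := ne_of_varVertex_ne hpq
    have n2 : p.swap ≠ q := ne_of_varVertex_ne (by simpa using hpq)
    have n3 : p ≠ q.swap := ne_of_varVertex_ne (by simpa using hpq)
    have n5 := swap_ne_self p
    have n6 := swap_ne_self q
    have hoff : ∀ r, varVertex r ≠ varVertex p → varVertex r ≠ varVertex q → c r = d r := by
      intro r hrp hrq
      have h1 := hca r
      have h2 := hd r
      simp only [Finsupp.add_apply, Finsupp.single_apply] at h1 h2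
      grind [varVertex_swap]
    -- Exponents of `c` are at most one at `p`, `q` and zero at their swaps. Parity excludes a
    -- change at just one of the two vertices, so both exponents drop from one to zero.
    have hpar := hcd.parity_of_eq_off_pair hpq hoff
    have hdiff : ¬ (c p = d p ∧ c q = d q) := fun ⟨e1, e2⟩ =>
      hne (hcd.eq_of_eq_off_pair hoff e1 e2)
    have hp := hcd.add_swap p
    have hq := hcd.add_swap q
    have h1 := hca p
    have h2 := hca q
    have h3 := hca p.swap
    have h4 := hca q.swap
    simp only [Finsupp.add_apply, Finsupp.single_apply, n1, n1.symm, n2.symm, n3, n5.symm,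
      n6.symm, if_true, if_false] at h1 h2 h3 h4
    refine ⟨varExp_add_le n1 (by omega) (by omega), fun s has hbs => ?_⟩
    simp only [Finsupp.add_apply, Finsupp.single_apply] at has
    have : s = p ∨ s = q := by grind
    rcases this with rfl | rfl <;> omega
  | even p q t hpq hs htp htq =>
    have n1 : p ≠ q := ne_of_varVertex_ne hpq
    have n2 : p.swap ≠ q := ne_of_varVertex_ne (by simpa using hpq)
    have n3 : p ≠ q.swap := ne_of_varVertex_ne (by simpa using hpq)
    have n5 := swap_ne_self p
    have n6 := swap_ne_self q
    have n7 := ne_of_varVertex_ne htp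
    have n8 := ne_of_varVertex_ne htq
    have n9 : t ≠ p.swap := ne_of_varVertex_ne (by simpa using htp)
    have n10 : t ≠ q.swap := ne_of_varVertex_ne (by simpa using htq)
    have hzero : ∀ r, varVertex r ≠ varVertex p → varVertex r ≠ varVertex q → r ≠ t →
        c r = 0 ∧ d r = 0 := by
      intro r hrp hrq hrt
      have h1 := hca r
      have h2 := hd r
      simp only [Finsupp.add_apply, Finsupp.single_apply] at h1 h2
      grind [varVertex_swap]
    have hoff : ∀ r, varVertex r ≠ varVertex p → varVertex r ≠ varVertex q → c r = d r := by
      intro r hrp hrq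
      by_cases hrt : r = t
      · subst hrt
        have h1 := hcd.add_swap r
        have h2 := hzero r.swap (by simpa using hrp) (by simpa using hrq) (swap_ne_self r)
        omega
      · have := hzero r hrp hrq hrt
        omega
    have hpar := hcd.parity_of_eq_off_pair hpq hoff
    have hdiff : ¬ (c p = d p ∧ c q = d q) := fun ⟨e1, e2⟩ =>
      hne (hcd.eq_of_eq_off_pair hoff e1 e2)
    have hp := hcd.add_swap p
    have hq := hcd.add_swap q
    have h1 := hca p
    have h2 := hca q
    have h3 := hca p.swap
    have h4 := hca q.swap
    simp only [Finsupp.add_apply, Finsupp.single_apply, n1, n1.symm, n2.symm, n3, n5.symm,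
      n6.symm, n7, n8, n9, n10, if_true, if_false] at h1 h2 h3 h4
    -- Without the catalyst `c` lives on two vertices, where opposite types cannot drop together.
    have ht : 0 < c t := by
      by_contra! ht
      have := hcd.add_eq_add_of_isLeft_ne hpq hs fun r hrp hrq => by
        by_cases hrt : r = t
        · subst hrt
          omega
        · exact (hzero r hrp hrq hrt).1
      omega
    refine ⟨varExp_add_add_le n1 n7 n8 (by omega) (by omega) ht, fun s has hbs => ?_⟩
    simp only [Finsupp.add_apply, Finsupp.single_apply] at has hbs
    have : s = p ∨ s = q := by grind
    rcases this with rfl | rfl <;> omega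
  | loop p t t' htp htp' htt =>
    have n1 := ne_of_varVertex_ne htp
    have n2 := ne_of_varVertex_ne htp'
    have n3 := ne_of_varVertex_ne htt
    have n4 : t ≠ p.swap := ne_of_varVertex_ne (by simpa using htp)
    have n5 : t' ≠ p.swap := ne_of_varVertex_ne (by simpa using htp')
    have n6 := swap_ne_self p
    have hzero : ∀ r, varVertex r ≠ varVertex p → r ≠ t → r ≠ t' → c r = 0 ∧ d r = 0 := by
      intro r hrp hrt hrt'
      have h1 := hca r
      have h2 := hd r
      simp only [Finsupp.add_apply, Finsupp.single_apply] at h1 h2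
      grind [varVertex_swap]
    have hoff : ∀ r, varVertex r ≠ varVertex p → c r = d r := by
      intro r hrp
      by_cases hrt : r = t ∨ r = t'
      · have h1 := hcd.add_swap r
        have h2 := hzero r.swap (by simpa using hrp)
          (by rcases hrt with rfl | rfl
              · exact swap_ne_self r
              · exact ne_of_varVertex_ne (by simpa using htt.symm))
          (by rcases hrt with rfl | rfl
              · exact ne_of_varVertex_ne (by simpa using htt)
              · exact swap_ne_self r)
        omega
      · have := hzero r hrp (by tauto) (by tauto)
        omega
    -- Since `c p ≤ 2`, parity leaves only the drop from two to zero.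
    have hpar := hcd.parity_of_eq_off hoff
    have hdiff : c p ≠ d p := fun e =>
      hne (hcd.eq_of_eq_off_pair (p := p) (q := p) (fun r hr _ => hoff r hr) e e)
    have hp := hcd.add_swap p
    have h1 := hca p
    have h3 := hca p.swap
    simp only [Finsupp.add_apply, Finsupp.single_apply, n1, n2, n4, n5, n6.symm,
      if_true, if_false] at h1 h3
    -- If `r'` were absent, `c` would live on the vertices of `p` and `r`; as it agrees with `d` at
    -- `r`, the two-vertex invariant would give `c p = d p`. This is used for `t` and `t'` in both
    -- roles.
    have key : ∀ r r' : V ⊕ V, varVertex r ≠ varVertex p → (∀ s, varVertex s ≠ varVertex p →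
        s ≠ r → s ≠ r' → c s = 0) → 0 < c r' := by
      intro r r' hrp hz
      by_contra! hr'
      have hz' : ∀ s, varVertex s ≠ varVertex p → varVertex s ≠ varVertex r → c s = 0 := by
        intro s hsp hsr
        by_cases hsr' : s = r'
        · subst hsr'
          omega
        · exact hz s hsp (ne_of_varVertex_ne hsr) hsr'
      have he := hoff r hrp
      by_cases hs : p.isLeft = r.isLeft
      · have := hcd.add_eq_add_of_isLeft_eq hrp.symm hs hz'
        omega
      · have := hcd.add_eq_add_of_isLeft_ne hrp.symm hs hz'
        omega
    have ht' : 0 < c t' := key t t' htp fun s hs hst hst' => (hzero s hs hst hst').1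
    have ht : 0 < c t := key t' t htp' fun s hs hst' hst => (hzero s hs hst hst').1
    refine ⟨varExp_two_add_le n1 n2 n3 (by omega) ht ht', fun s has hbs => ?_⟩
    simp only [Finsupp.add_apply, Finsupp.single_apply] at has hbs
    have : s = p := by grind
    subst this
    omega

/-- The weight that is zero on the variables of `b`, one on the other variables of `a`, and
large on the remaining variables. -/
noncomputable def pairWeight (a b : V ⊕ V →₀ ℕ) : (V ⊕ V →₀ ℕ) →+ ℕ :=
  Finsupp.weight fun s => if b s ≠ 0 then 0 else if a s ≠ 0 then 1 else a.degree + 1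

theorem pairWeight_right (a b : V ⊕ V →₀ ℕ) : pairWeight a b b = 0 := by
  rw [pairWeight, Finsupp.weight_apply]
  refine Finset.sum_eq_zero fun s hs => ?_
  simp [Finsupp.mem_support_iff.1 hs]

theorem pairWeight_left_le (a b : V ⊕ V →₀ ℕ) : pairWeight a b a ≤ a.degree := by
  rw [pairWeight, Finsupp.weight_apply, Finsupp.degree_apply]
  refine Finset.sum_le_sum fun s hs => ?_
  have := Finsupp.mem_support_iff.1 hs
  by_cases hb : b s = 0 <;> simp [hb, this]

theorem le_pairWeight (a b c : V ⊕ V →₀ ℕ) {s : V ⊕ V} (hs : c s ≠ 0) :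
    (if b s ≠ 0 then 0 else if a s ≠ 0 then 1 else a.degree + 1) ≤ pairWeight a b c := by
  exact Finsupp.le_weight_of_ne_zero
    (w := fun s => if b s ≠ 0 then 0 else if a s ≠ 0 then 1 else a.degree + 1)
    (fun _ => Nat.zero_le _) hs

/-- Anything below `b` has weight zero, hence only variables of `b`, hence equals `b` when congruent
to it. Anything below a divisor of `a` has weight at most `a.degree`, which excludes the variables
outside the pair, and `PathPair.eq_of_le` applies. -/
theorem PathPair.mem_universalGroebnerBasis [Fintype V] {a b : V ⊕ V →₀ ℕ} (h : PathPair a b)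
    (hne : a ≠ b) :
    (monomial a 1 - monomial b 1 : MvPolynomial (V ⊕ V) F) ∈
      universalGroebnerBasis (binomialIdeal F (edgeMoves (⊤ : SimpleGraph V))) := by
  obtain ⟨m, hm⟩ := exists_monomialOrder_of_weight (pairWeight a b)
  have hrel : CompleteRel F a b := h.completeRel
  have hb : b ∉ nonstandard m (binomialIdeal F (edgeMoves (⊤ : SimpleGraph V))) := by
    rintro ⟨d, hbd, hlt⟩
    have hw := hm _ _ hlt.le
    rw [pairWeight_right] at hw
    have : d = b := h.eq_of_support_subset hbd fun s hs => by
      by_contra hds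
      have := le_pairWeight a b d hds
      simp only [hs, ne_eq, not_true_eq_false, if_false] at this
      split_ifs at this <;> omega
    exact hlt.ne (by rw [this])
  refine mem_universalGroebnerBasis_of_minimal (m := m) ⟨⟨b, hrel, ?_⟩, ?_⟩ hb hrel
  · exact lt_of_le_of_ne (le_of_notMem_nonstandard hrel hb)
      fun h => hne (m.toSyn.injective h).symm
  · rintro c ⟨d, hcd, hlt⟩ hca
    have hw := (hm _ _ hlt.le).trans ((hm _ _ (m.toSyn_monotone hca)).trans
      (pairWeight_left_le a b))
    refine (h.eq_of_le hca hcd (fun e => hlt.ne (by rw [e])) fun s has hbs => ?_).1.ge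
    by_contra hds
    have := le_pairWeight a b d hds
    simp only [has, hbs, ne_eq, not_true_eq_false, if_false] at this
    omega

end PathPairs

/-! ### Minimal paths in a complete graph -/

section CompleteGraph

variable {V : Type u}

/-- Walks in a complete graph on at most two given vertices alternate between them. -/
theorem even_length_iff_of_support_subset_pair {i a : V} :
    ∀ {v w : V} (p : (⊤ : SimpleGraph V).Walk v w), (∀ x ∈ p.support, x = i ∨ x = a) →
      (Even p.length ↔ v = w)
  | _, _, .nil, _ => by simp
  | v, w, .cons (v := x) h p, hs => by
    have ih := even_length_iff_of_support_subset_pair p fun y hy => hs y (by simp [hy])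
    have hvx : v ≠ x := h
    have h1 := hs v (by simp)
    have h2 := hs x (by simp)
    have h3 := hs w (by simp)
    rw [SimpleGraph.Walk.length_cons, Nat.even_add_one, ih]
    grind

/-- The path `(i, j)` in a complete graph. -/
def edgeWalk {i j : V} (h : i ≠ j) : (⊤ : SimpleGraph V).Walk i j :=
  .cons h .nil

/-- The path `(i, k, j)` in a complete graph. -/
def throughWalk {i k j : V} (h : i ≠ k) (h' : k ≠ j) : (⊤ : SimpleGraph V).Walk i j :=
  .cons h (edgeWalk h')

/-- The path `(i, k, l, i)` in a complete graph. -/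
def triangleWalk {i k l : V} (h : i ≠ k) (h' : k ≠ l) (h'' : l ≠ i) :
    (⊤ : SimpleGraph V).Walk i i :=
  .cons h (throughWalk h' h'')

@[simp] theorem support_edgeWalk {i j : V} (h : i ≠ j) : (edgeWalk h).support = [i, j] := rfl

@[simp] theorem support_throughWalk {i k j : V} (h : i ≠ k) (h' : k ≠ j) :
    (throughWalk h h').support = [i, k, j] := rfl

@[simp] theorem support_triangleWalk {i k l : V} (h : i ≠ k) (h' : k ≠ l) (h'' : l ≠ i) :
    (triangleWalk h h' h'').support = [i, k, l, i] := rfl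

@[simp] theorem length_edgeWalk {i j : V} (h : i ≠ j) : (edgeWalk h).length = 1 := rfl

@[simp] theorem length_throughWalk {i k j : V} (h : i ≠ k) (h' : k ≠ j) :
    (throughWalk h h').length = 2 := rfl

@[simp] theorem length_triangleWalk {i k l : V} (h : i ≠ k) (h' : k ≠ l) (h'' : l ≠ i) :
    (triangleWalk h h' h'').length = 3 := rfl

theorem length_eq_of_support_eq {i j : V} {p : (⊤ : SimpleGraph V).Walk i j} {l : List V}
    (h : p.support = l) : p.length + 1 = l.length := by
  rw [← h, SimpleGraph.Walk.length_support]

theorem support_of_length_eq_zero {i j : V} (p : (⊤ : SimpleGraph V).Walk i j)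
    (h : p.length = 0) : p.support = [i] := by
  cases p with
  | nil => rfl
  | cons h' q => simp at h

theorem support_of_length_eq_one {i j : V} (p : (⊤ : SimpleGraph V).Walk i j)
    (h : p.length = 1) : i ≠ j ∧ p.support = [i, j] := by
  cases p with
  | nil => simp at h
  | cons h' q =>
    cases q with
    | nil => exact ⟨h', rfl⟩
    | cons h'' q => simp at h

theorem support_of_length_eq_two {i j : V} (p : (⊤ : SimpleGraph V).Walk i j)
    (h : p.length = 2) : ∃ k, k ≠ i ∧ k ≠ j ∧ p.support = [i, k, j] := by
  cases p with
  | nil => simp at h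
  | cons h' q =>
    obtain ⟨hk, hq⟩ := support_of_length_eq_one q (by simpa using h)
    exact ⟨_, h'.symm, hk, by rw [SimpleGraph.Walk.support_cons, hq]⟩

theorem support_of_length_eq_three {i j : V} (p : (⊤ : SimpleGraph V).Walk i j)
    (h : p.length = 3) : ∃ k l, k ≠ i ∧ l ≠ j ∧ k ≠ l ∧ p.support = [i, k, l, j] := by
  cases p with
  | nil => simp at h
  | cons h' q =>
    obtain ⟨l, hl, hl', hq⟩ := support_of_length_eq_two q (by simpa using h)
    exact ⟨_, l, h'.symm, hl', hl.symm, by rw [SimpleGraph.Walk.support_cons, hq]⟩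

variable [DecidableEq V]

theorem mem_pathInterior {G : SimpleGraph V} {i j k : V} {p : G.Walk i j} :
    k ∈ pathInterior p ↔ k ∈ p.support ∧ k ≠ i ∧ k ≠ j := by
  simp [pathInterior]

/-- The pattern for all four types: compare with a short walk of the same ends and parity through
vertices of `p`. Condition (i) removes every other interior vertex, and condition (ii) then bounds
the length. -/
theorem IsMinimalPath.support_of_even_of_eq {i : V} {p : (⊤ : SimpleGraph V).Walk i i}
    (hp : IsMinimalPath p) (he : Even p.length) : p.support = [i] := by
  have hint : pathInterior p = ∅ := by
    refine Finset.eq_empty_of_forall_notMem fun k hk => hp.1 k hk ⟨.nil, by simp [he], ?_⟩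
    simpa using (mem_pathInterior.1 hk).2.1.symm
  apply support_of_length_eq_zero
  by_contra h0
  exact hp.2 ⟨.nil, by simpa using Nat.pos_of_ne_zero h0, by simp [he],
    by rw [hint]; simp [pathInterior]⟩

theorem IsMinimalPath.support_of_odd_of_ne {i j : V} {p : (⊤ : SimpleGraph V).Walk i j}
    (hij : i ≠ j) (hp : IsMinimalPath p) (ho : ¬ Even p.length) : p.support = [i, j] := by
  have hint : pathInterior p = ∅ := by
    refine Finset.eq_empty_of_forall_notMem fun k hk =>
      hp.1 k hk ⟨edgeWalk hij, by simp [ho], ?_⟩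
    have := mem_pathInterior.1 hk
    simp [this.2.1.symm, this.2.2.symm]
  refine (support_of_length_eq_one p ?_).2
  by_contra h1
  have h0 : p.length ≠ 0 := fun h => ho (by simp [h])
  refine hp.2 ⟨edgeWalk hij, by simp; omega, by simp [ho], ?_⟩
  rw [hint]
  ext k
  simp only [mem_pathInterior, support_edgeWalk, List.mem_cons, List.not_mem_nil]
  grind

theorem IsMinimalPath.support_of_even_of_ne {i j : V} {p : (⊤ : SimpleGraph V).Walk i j}
    (hij : i ≠ j) (hp : IsMinimalPath p) (he : Even p.length) :
    ∃ k, k ≠ i ∧ k ≠ j ∧ p.support = [i, k, j] := by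
  -- An even walk confined to `i` and `j` would be closed.
  obtain ⟨k, hk, hki, hkj⟩ : ∃ k ∈ p.support, k ≠ i ∧ k ≠ j := by
    by_contra! h
    exact hij ((even_length_iff_of_support_subset_pair (i := i) (a := j) p
      fun x hx => or_iff_not_imp_left.2 (h x hx)).1 he)
  have hint : ∀ m ∈ pathInterior p, m = k := by
    intro m hm
    by_contra hmk
    have hm' := mem_pathInterior.1 hm
    refine hp.1 m hm ⟨throughWalk hki.symm hkj, by simp [he], ?_⟩
    simp [hk, Ne.symm hmk, hm'.2.1.symm, hm'.2.2.symm]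
  apply support_of_length_eq_two
  by_contra h2
  have h0 : p.length ≠ 0 := fun h => hij (SimpleGraph.Walk.eq_of_length_eq_zero h)
  have h2' : 2 < p.length := by
    obtain ⟨r, hr⟩ := he
    omega
  refine hp.2 ⟨throughWalk hki.symm hkj, by simpa using h2', by simp [he], ?_⟩
  ext m
  constructor
  · intro hm
    rw [mem_pathInterior] at hm ⊢
    simp only [support_throughWalk, List.mem_cons, List.not_mem_nil] at hm
    grind
  · intro hm
    rw [hint m hm, mem_pathInterior]
    simp [hki, hkj]

theorem IsMinimalPath.support_of_odd_of_eq {i : V} {p : (⊤ : SimpleGraph V).Walk i i}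
    (hp : IsMinimalPath p) (ho : ¬ Even p.length) :
    ∃ k l, k ≠ i ∧ l ≠ i ∧ k ≠ l ∧ p.support = [i, k, l, i] := by
  -- An odd closed walk does not fit on two vertices. Taking `a = i` and then `a = k` yields two
  -- distinct interior vertices.
  have hex : ∀ a, ∃ k ∈ p.support, k ≠ i ∧ k ≠ a := by
    intro a
    by_contra! h
    exact ho ((even_length_iff_of_support_subset_pair (i := i) (a := a) p
      fun x hx => or_iff_not_imp_left.2 (h x hx)).2 rfl)
  obtain ⟨k, hk, hki, -⟩ := hex i
  obtain ⟨l, hl, hli, hlk⟩ := hex k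
  have hodd : ¬ Even 3 := by decide
  have hint : ∀ m ∈ pathInterior p, m = k ∨ m = l := by
    intro m hm
    by_contra! hmk
    have hm' := mem_pathInterior.1 hm
    refine hp.1 m hm ⟨triangleWalk hki.symm hlk.symm hli, by simp [ho, hodd], ?_⟩
    simp [hk, hl, hmk.1.symm, hmk.2.symm, hm'.2.1.symm]
  apply support_of_length_eq_three
  by_contra h3
  have h1 : p.length ≠ 1 := fun h => (support_of_length_eq_one p h).1 rfl
  have h3' : 3 < p.length := by
    rw [Nat.not_even_iff_odd] at ho
    obtain ⟨r, hr⟩ := ho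
    omega
  refine hp.2 ⟨triangleWalk hki.symm hlk.symm hli, by simpa using h3', by simp [ho, hodd], ?_⟩
  ext m
  constructor
  · intro hm
    rw [mem_pathInterior] at hm ⊢
    simp only [support_triangleWalk, List.mem_cons, List.not_mem_nil] at hm
    grind
  · intro hm
    rw [mem_pathInterior]
    rcases hint m hm with rfl | rfl <;> simp [hki, hli]

theorem isMinimalPath_of_support_singleton {i j : V} {p : (⊤ : SimpleGraph V).Walk i j}
    (h : p.support = [i]) : IsMinimalPath p := by
  have hl : p.length = 0 := by simpa using length_eq_of_support_eq h
  refine ⟨fun k hk => ?_, fun ⟨q, hq, _⟩ => ?_⟩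
  · have := mem_pathInterior.1 hk
    rw [h, List.mem_singleton] at this
    exact absurd this.1 this.2.1
  · omega

theorem isMinimalPath_of_support_pair {i j : V} {p : (⊤ : SimpleGraph V).Walk i j}
    (h : p.support = [i, j]) : IsMinimalPath p := by
  have hl := length_eq_of_support_eq h
  simp only [List.length_cons, List.length_nil] at hl
  refine ⟨fun k hk => ?_, fun ⟨q, hq, hpar, _⟩ => ?_⟩
  · have := mem_pathInterior.1 hk
    simp [h] at this
    grind
  · have h0 : q.length = 0 := by omega
    have h1 : p.length = 1 := by omega
    rw [h0, h1] at hpar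
    simp at hpar

theorem isMinimalPath_of_support_triple {i j k : V} {p : (⊤ : SimpleGraph V).Walk i j}
    (hij : i ≠ j) (h : p.support = [i, k, j]) : IsMinimalPath p := by
  have hl : p.length = 2 := by simpa using length_eq_of_support_eq h
  refine ⟨?_, ?_⟩
  · rintro m hm ⟨q, hpar, hq⟩
    rw [hl] at hpar
    refine hij ((even_length_iff_of_support_subset_pair (i := i) (a := j) q fun x hx => ?_).1
      (hpar.2 even_two))
    have h1 := hq x hx
    have h2 := mem_pathInterior.1 hm
    simp only [h, List.mem_cons, List.not_mem_nil] at h1 h2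
    grind
  · rintro ⟨q, hq, hpar, -⟩
    rw [hl] at hpar hq
    obtain ⟨r, hr⟩ := hpar.2 even_two
    exact hij (SimpleGraph.Walk.eq_of_length_eq_zero (p := q) (by omega))

theorem isMinimalPath_of_support_triangle {i k l : V} {p : (⊤ : SimpleGraph V).Walk i i}
    (h : p.support = [i, k, l, i]) : IsMinimalPath p := by
  have hl : p.length = 3 := by simpa using length_eq_of_support_eq h
  have hodd : ¬ Even 3 := by decide
  refine ⟨?_, ?_⟩
  · rintro m hm ⟨q, hpar, hq⟩
    rw [hl] at hpar
    have h2 := mem_pathInterior.1 hm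
    simp only [h, List.mem_cons, List.not_mem_nil] at h2
    refine hodd (hpar.1 ((even_length_iff_of_support_subset_pair (i := i)
      -- The interior vertex that survives the removal of `m`.
      (a := if m = k then l else k) q fun x hx => ?_).2 rfl))
    have h1 := hq x hx
    simp only [h, List.mem_cons, List.not_mem_nil] at h1
    grind
  · rintro ⟨q, hq, hpar, -⟩
    rw [hl] at hpar hq
    have hqo := Nat.not_even_iff_odd.1 fun he => hodd (hpar.1 he)
    obtain ⟨r, hr⟩ := hqo
    exact (support_of_length_eq_one q (by omega)).1 rfl

/-- The minimal paths in a complete graph. -/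
theorem isMinimalPath_top_iff {i j : V} (p : (⊤ : SimpleGraph V).Walk i j) :
    IsMinimalPath p ↔
      p.support = [i] ∨
      (i ≠ j ∧ p.support = [i, j]) ∨
      (∃ k, i ≠ j ∧ k ≠ i ∧ k ≠ j ∧ p.support = [i, k, j]) ∨
      (∃ k l, i = j ∧ k ≠ i ∧ l ≠ i ∧ k ≠ l ∧ p.support = [i, k, l, i]) := by
  constructor
  · intro hp
    by_cases hij : i = j
    · subst hij
      by_cases he : Even p.length
      · exact Or.inl (hp.support_of_even_of_eq he)
      · obtain ⟨k, l, h1, h2, h3, h4⟩ := hp.support_of_odd_of_eq he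
        exact Or.inr (Or.inr (Or.inr ⟨k, l, rfl, h1, h2, h3, h4⟩))
    · by_cases he : Even p.length
      · obtain ⟨k, h1, h2, h3⟩ := hp.support_of_even_of_ne hij he
        exact Or.inr (Or.inr (Or.inl ⟨k, hij, h1, h2, h3⟩))
      · exact Or.inr (Or.inl ⟨hij, hp.support_of_odd_of_ne hij he⟩)
  · rintro (h | ⟨-, h⟩ | ⟨k, hij, -, -, h⟩ | ⟨k, l, rfl, -, -, -, h⟩)
    · exact isMinimalPath_of_support_singleton h
    · exact isMinimalPath_of_support_pair h
    · exact isMinimalPath_of_support_triple hij h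
    · exact isMinimalPath_of_support_triangle h

end CompleteGraph

/-! ### Path binomials as pairs of exponents -/

section PathBinomials

variable {V : Type u} {F : Type v} [Field F]

theorem PathPair.ne {a b : V ⊕ V →₀ ℕ} (h : PathPair a b) : a ≠ b := by
  obtain ⟨p, hp, hp'⟩ : ∃ p, a p ≠ 0 ∧ b p.swap ≠ 0 := by
    cases h with
    | odd p q => exact ⟨p, by simp, by simp⟩
    | even p q t => exact ⟨p, by simp, by simp⟩
    | loop p t t' => exact ⟨p, by simp, by simp⟩
  rintro rfl
  have := h.swap_eq_zero hp'
  rw [Sum.swap_swap] at this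
  exact hp this

theorem exists_eq_X_of_eq_xVar_or_eq_yVar {k : V} {f : MvPolynomial (V ⊕ V) F}
    (h : f = xVar F k ∨ f = yVar F k) : ∃ t : V ⊕ V, varVertex t = k ∧ f = X t := by
  rcases h with h | h
  · exact ⟨Sum.inl k, rfl, h⟩
  · exact ⟨Sum.inr k, rfl, h⟩

theorem X_eq_xVar_or_eq_yVar (t : V ⊕ V) :
    (X t : MvPolynomial (V ⊕ V) F) = xVar F (varVertex t) ∨
      (X t : MvPolynomial (V ⊕ V) F) = yVar F (varVertex t) := by
  rcases t with k | k
  · exact Or.inl rfl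
  · exact Or.inr rfl

variable [DecidableEq V]

theorem exists_pathPair_of_mem {f : MvPolynomial (V ⊕ V) F}
    (hf : f ∈ minimalPathBinomials F (⊤ : SimpleGraph V)) :
    ∃ a b, PathPair a b ∧ f = monomial a 1 - monomial b 1 := by
  obtain ⟨⟨i, j, p, hp, t, ht, hft⟩, h0⟩ := hf
  rcases (isMinimalPath_top_iff p).1 hp with
    h | ⟨hij, h⟩ | ⟨k, hij, hki, hkj, h⟩ | ⟨k, l, rfl, hki, hli, hkl, h⟩
  · have hl : p.length = 0 := by simpa using length_eq_of_support_eq h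
    obtain rfl := SimpleGraph.Walk.eq_of_length_eq_zero hl
    rcases hft with ⟨ho, -⟩ | ⟨-, rfl⟩
    · simp [hl] at ho
    -- The path `(i)` gives `x_i y_i - y_i x_i = 0`.
    · refine absurd ?_ h0
      rw [Set.mem_singleton_iff, mul_comm (yVar F i), sub_self, zero_mul]
  · have hl : p.length = 1 := by simpa using length_eq_of_support_eq h
    have hint : pathInterior p = ∅ := by
      ext m
      simp only [mem_pathInterior, h, List.mem_cons, List.not_mem_nil]
      grind
    rw [hint, Finset.prod_empty, mul_one, mul_one, hl] at hft
    rcases hft with ⟨-, rfl | rfl⟩ | ⟨he, -⟩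
    · exact ⟨_, _, PathPair.odd (Sum.inl i) (Sum.inl j) hij rfl,
        by simp [xVar, yVar, X, monomial_mul]⟩
    · exact ⟨_, _, PathPair.odd (Sum.inr i) (Sum.inr j) hij rfl,
        by simp [xVar, yVar, X, monomial_mul]⟩
    · simp at he
  · have hl : p.length = 2 := by simpa using length_eq_of_support_eq h
    have hint : pathInterior p = {k} := by
      ext m
      simp only [mem_pathInterior, h, List.mem_cons, List.not_mem_nil, Finset.mem_singleton]
      grind
    rw [hint, Finset.prod_singleton, hl] at hft
    obtain ⟨s, rfl, hs⟩ := exists_eq_X_of_eq_xVar_or_eq_yVar (ht k)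
    rw [hs] at hft
    rcases hft with ⟨ho, -⟩ | ⟨-, rfl⟩
    · exact absurd ho (by decide)
    · exact ⟨_, _, PathPair.even (Sum.inl i) (Sum.inr j) s hij (by simp) hki hkj,
        by simp [xVar, yVar, X, monomial_mul, sub_mul]⟩
  · have hl : p.length = 3 := by simpa using length_eq_of_support_eq h
    have hint : pathInterior p = {k, l} := by
      ext m
      simp only [mem_pathInterior, h, List.mem_cons, List.not_mem_nil, Finset.mem_singleton,
        Finset.mem_insert]
      grind
    rw [hint, Finset.prod_pair hkl, hl] at hft
    obtain ⟨s, rfl, hs⟩ := exists_eq_X_of_eq_xVar_or_eq_yVar (ht k)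
    obtain ⟨s', rfl, hs'⟩ := exists_eq_X_of_eq_xVar_or_eq_yVar (ht l)
    rw [hs, hs'] at hft
    rcases hft with ⟨-, rfl | rfl⟩ | ⟨he, -⟩
    · exact ⟨_, _, PathPair.loop (Sum.inl i) s s' hki hli hkl,
        by simp [xVar, yVar, X, monomial_mul, sub_mul]⟩
    · exact ⟨_, _, PathPair.loop (Sum.inr i) s s' hki hli hkl,
        by simp [xVar, yVar, X, monomial_mul, sub_mul]⟩
    · exact absurd he (by decide)

theorem PathPair.mem_minimalPathBinomials {a b : V ⊕ V →₀ ℕ} (h : PathPair a b) :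
    (monomial a 1 - monomial b 1 : MvPolynomial (V ⊕ V) F) ∈
      minimalPathBinomials F (⊤ : SimpleGraph V) := by
  refine ⟨?_, fun h0 => h.ne (monomial_left_injective (one_ne_zero (α := F)) (sub_eq_zero.1 h0))⟩
  cases h with
  | odd p q hpq hs =>
    have hint : pathInterior (edgeWalk hpq) = ∅ := by
      ext m
      simp only [mem_pathInterior, support_edgeWalk, List.mem_cons, List.not_mem_nil]
      grind
    refine ⟨_, _, edgeWalk hpq, isMinimalPath_of_support_pair rfl, xVar F, fun k => Or.inl rfl,
      Or.inl ⟨by simp, ?_⟩⟩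
    rw [hint]
    rcases p with i | i <;> rcases q with j | j
    · left; simp [xVar, yVar, X, monomial_mul]
    · simp at hs
    · simp at hs
    · right; simp [xVar, yVar, X, monomial_mul]
  | even p q t hpq hs htp htq =>
    -- Even paths carry no sign: the negative binomial comes from the reversed path, so `key` is
    -- applied to both `(i, j)` and `(j, i)`.
    have key : ∀ i j : V, i ≠ j → ∀ hti : varVertex t ≠ i, ∀ htj : varVertex t ≠ j,
        (xVar F i * yVar F j - yVar F i * xVar F j) * X t ∈
          {f | ∃ (i j : V) (p : (⊤ : SimpleGraph V).Walk i j),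
            IsMinimalPath p ∧ f ∈ pathBinomials F p} := by
      intro i j hij hti htj
      have hint : pathInterior (throughWalk hti.symm htj) = {varVertex t} := by
        ext m
        simp only [mem_pathInterior, support_throughWalk, List.mem_cons, List.not_mem_nil,
          Finset.mem_singleton]
        grind
      refine ⟨i, j, throughWalk hti.symm htj, isMinimalPath_of_support_triple hij rfl,
        Function.update (xVar F) (varVertex t) (X t), fun k => ?_, Or.inr ⟨by simp, ?_⟩⟩
      · by_cases hk : k = varVertex t
        · subst hk
          simpa using X_eq_xVar_or_eq_yVar t
        · simp [hk]
      · rw [hint, Finset.prod_singleton, Function.update_self]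
    rcases p with i | i <;> rcases q with j | j
    · simp at hs
    · convert key i j hpq htp htq using 1
      simp [xVar, yVar, X, monomial_mul, sub_mul]
    · convert key j i hpq.symm htq htp using 1
      simp [xVar, yVar, X, monomial_mul, sub_mul, add_comm]
    · simp at hs
  | loop p t t' htp htp' htt =>
    have hint : pathInterior (triangleWalk htp.symm htt htp') = {varVertex t, varVertex t'} := by
      ext m
      simp only [mem_pathInterior, support_triangleWalk, List.mem_cons, List.not_mem_nil,
        Finset.mem_singleton, Finset.mem_insert]
      grind
    refine ⟨_, _, triangleWalk htp.symm htt htp', isMinimalPath_of_support_triangle rfl,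
      Function.update (Function.update (xVar F) (varVertex t) (X t)) (varVertex t') (X t'),
      fun k => ?_, Or.inl ⟨by rw [length_triangleWalk]; decide, ?_⟩⟩
    · by_cases hk : k = varVertex t'
      · subst hk
        simpa using X_eq_xVar_or_eq_yVar t'
      · by_cases hk' : k = varVertex t
        · subst hk'
          simpa [hk] using X_eq_xVar_or_eq_yVar t
        · simp [hk, hk']
    · rw [hint, Finset.prod_pair htt, Function.update_self, Function.update_of_ne htt,
        Function.update_self]
      rcases p with i | i
      · left; simp [xVar, yVar, X, monomial_mul, sub_mul]
      · right; simp [xVar, yVar, X, monomial_mul, sub_mul]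

end PathBinomials

/-- A path pair divides the binomial termwise, and primitivity turns divisibility into equality. -/
theorem graverBasis_subset_minimalPathBinomials {V : Type u} [Fintype V] [DecidableEq V]
    {F : Type v} [Field F] :
    graverBasis (parityBinomialEdgeIdeal F (⊤ : SimpleGraph V)) ⊆
      minimalPathBinomials F (⊤ : SimpleGraph V) := by
  rw [parityBinomialEdgeIdeal_eq_binomialIdeal]
  rintro _ ⟨a, b, hab, rfl, hmem, hprim⟩
  obtain ⟨a', b', hpair, ha, hb⟩ := CompleteRel.exists_pathPair_le (F := F) hmem hab
  obtain ⟨rfl, rfl⟩ := hprim a' b' hpair.ne hpair.completeRel ha hb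
  exact hpair.mem_minimalPathBinomials

theorem minimalPathBinomials_subset_universalGroebnerBasis {V : Type u} [Fintype V]
    [DecidableEq V] {F : Type v} [Field F] :
    minimalPathBinomials F (⊤ : SimpleGraph V) ⊆
      universalGroebnerBasis (parityBinomialEdgeIdeal F (⊤ : SimpleGraph V)) := by
  rw [parityBinomialEdgeIdeal_eq_binomialIdeal]
  intro f hf
  obtain ⟨a, b, hpair, rfl⟩ := exists_pathPair_of_mem hf
  exact hpair.mem_universalGroebnerBasis hpair.ne

theorem mainTheorem2 (F : Type*) [Field F] (n : ℕ) :
    (minimalPathBinomials F (⊤ : SimpleGraph (Fin n)) =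
        universalGroebnerBasis (parityBinomialEdgeIdeal F (⊤ : SimpleGraph (Fin n))) ∧
      universalGroebnerBasis (parityBinomialEdgeIdeal F (⊤ : SimpleGraph (Fin n))) =
        graverBasis (parityBinomialEdgeIdeal F (⊤ : SimpleGraph (Fin n)))) ∧
    ∀ (i j : Fin n) (p : (⊤ : SimpleGraph (Fin n)).Walk i j),
      IsMinimalPath p ↔
        p.support = [i] ∨
        (i ≠ j ∧ p.support = [i, j]) ∨
        (∃ k, i ≠ j ∧ k ≠ i ∧ k ≠ j ∧ p.support = [i, k, j]) ∨
        (∃ k l, i = j ∧ k ≠ i ∧ l ≠ i ∧ k ≠ l ∧ p.support = [i, k, l, i]) := by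
  have h1 := minimalPathBinomials_subset_universalGroebnerBasis (V := Fin n) (F := F)
  have h2 := graverBasis_subset_minimalPathBinomials (V := Fin n) (F := F)
  have h3 : universalGroebnerBasis (parityBinomialEdgeIdeal F (⊤ : SimpleGraph (Fin n))) ⊆
      graverBasis (parityBinomialEdgeIdeal F (⊤ : SimpleGraph (Fin n))) := by
    rw [parityBinomialEdgeIdeal_eq_binomialIdeal]
    exact universalGroebnerBasis_subset_graverBasis _
  exact ⟨⟨h1.antisymm (h3.trans h2), h3.antisymm (h2.trans h1)⟩,
    fun i j p => isMinimalPath_top_iff p⟩
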